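/- Let $\mu>0$ and let $\sigma:(0,\infty)\to\mathbb R$, with $W(p)=\int_1^p\sigma(z)\,dz$, satisfy the following standing assumptions: $\sigma$ is locally Lipschitz; $\sigma(p)\to-\infty$ as $p\to0^+$; there are $\alpha,\theta>0$ with $\sigma'(p)\ge\alpha$ for $0<p<\theta$; $W$ is strictly convex on $[M,\infty)$ for some $M>0$; $\sigma(p)>0$ for all sufficiently large $p$, and $\int_{p_++1}^\infty \frac{dz}{\sigma(z)}<\infty$, where $p_+$ is the largest root of $\sigma$. Let $X=\{q\in L^2(0,1): q\ge0 \text{ a.e.},\ \int_0^1 q\,dx=\mu\}$ and let $\mathcal E_\mu=\{q\in L^2(0,1): q>0 \text{ a.e.},\ \sigma(q)=C \text{ a.e. for some constant } C,\ \int_0^1 q\,dx=\mu\}$ be the set of equilibria. For $p_0\in X$ consider problem (P): $$p_t(x,t)=-\sigma(p(x,t))+\int_0^1\sigma(p(y,t))\,dy,\qquad p(x,0)=p_0(x),\qquad \int_0^1p(x,t)\,dx=\mu.$$ A solution of (P) is a measurable function $p$ on $(0,1)\times[0,\infty)$ such that for every $T>0$: (i) $p\in C([0,T];L^2(0,1))$,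 $p(\cdot,0)=p_0$, and $\int_0^1p(x,t)\,dx=\mu$ for all $t\in[0,T]$; (ii) $p(x,t)>0$ for a.e. $(x,t)\in(0,1)\times[0,T]$, $\sigma(p(\cdot,t))\in L^1(0,1)$ for a.e. $t\in[0,T]$, and for a.e. $x\in(0,1)$ the function $t\mapsto\sigma(p(x,t))-\int_0^1\sigma(p(y,t))\,dy$ belongs to $L^1(\tau,T)$ for all $\tau>0$; (iii) for a.e. $x\in(0,1)$, $$p(x,t)=p(x,s)-\int_s^t\Big(\sigma(p(x,\tau))-\int_0^1\sigma(p(y,\tau))\,dy\Big)d\tau\quad\text{for all } s,t\in(0,T].$$ Assume the nondegeneracy condition: (a) $\sigma$ is $C^1$ on $(0,\infty)$ and the set $\mathcal S=\{z>0:\sigma'(z)=0\}$ of critical points has Lebesgue measure zero; (b) whenever $\alpha<\beta$, $[\alpha,\beta]\cap\sigma(\mathcal S)=\emptyset$, and $p_1,\dots,p_{2k+1}$ ($k\ge0$) are the distinct inverse functions of $\sigma$ on $[\alpha,\beta]$ (continuous functions whose values at each $c\in[\alpha,\beta]$ list the roots $z>0$ of $\sigma(z)=c$, each exactly once), the derivatives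 $p_1',\dots,p_{2k+1}'$ are linearly independent in $C^0([\alpha,\beta])$. Then for every $p_0\in X$, each solution $p$ of (P) with initial datum $p_0$ converges in $L^2(0,1)$, as $t\to\infty$, to some equilibrium $\bar p\in\mathcal E_\mu$. -/

import Mathlib

open MeasureTheory Set Filter
open scoped Topology

namespace QuasistaticVisco

/-- Lebesgue measure on the reference interval `(0,1)`. -/
noncomputable def unitMeasure : Measure ℝ := volume.restrict (Ioo (0 : ℝ) 1)

/-- The stored energy `W(p) = ∫₁ᵖ σ(z) dz`. -/
noncomputable def storedEnergy (σ : ℝ → ℝ) (p : ℝ) : ℝ := ∫ z in (1 : ℝ)..p, σ z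

/-- The standing assumptions on the stress `σ : (0,∞) → ℝ`. The stress is given as a function on
`ℝ`, but only its values on `(0,∞)` matter. -/
structure StressAssumptions (σ : ℝ → ℝ) : Prop where
  /-- `σ` is locally Lipschitz on `(0,∞)`. -/
  locallyLipschitz : LocallyLipschitzOn (Ioi (0 : ℝ)) σ
  /-- `σ(p) → -∞` as `p → 0+`. -/
  tendsto_zero : Tendsto σ (𝓝[>] (0 : ℝ)) atBot
  /-- `σ' ≥ α > 0` near `0`. -/
  deriv_lower_bound : ∃ α > (0 : ℝ), ∃ θ > (0 : ℝ), ∀ p ∈ Ioo (0 : ℝ) θ, α ≤ deriv σ p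
  /-- `W` is strictly convex for large `p`. -/
  strictConvex_large : ∃ M > (0 : ℝ), StrictConvexOn ℝ (Ici M) (storedEnergy σ)
  /-- `σ(p) > 0` for large `p`. -/
  pos_large : ∀ᶠ p in atTop, 0 < σ p
  /-- `∫_{p₊+1}^∞ dz / σ(z) < ∞`, where `p₊` is the largest root of `σ`. -/
  integrable_inv : ∃ pPlus : ℝ, IsGreatest {p : ℝ | 0 < p ∧ σ p = 0} pPlus ∧
    IntegrableOn (fun z => 1 / σ z) (Ioi (pPlus + 1)) volume

/-- The set `X` of admissible states: nonnegative functions in `L²(0,1)` with mean `μ`. -/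
def IsAdmissible (μ : ℝ) (q : ℝ → ℝ) : Prop :=
  MemLp q 2 unitMeasure ∧ (∀ᵐ x ∂unitMeasure, 0 ≤ q x) ∧ ∫ x, q x ∂unitMeasure = μ

/-- The set `E_μ` of equilibria: positive functions in `L²(0,1)` with mean `μ` on which the stress
is constant. -/
def IsEquilibrium (σ : ℝ → ℝ) (μ : ℝ) (q : ℝ → ℝ) : Prop :=
  MemLp q 2 unitMeasure ∧ (∀ᵐ x ∂unitMeasure, 0 < q x) ∧
    (∃ C : ℝ, ∀ᵐ x ∂unitMeasure, σ (q x) = C) ∧ ∫ x, q x ∂unitMeasure = μ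

/-- The nonlocal term `∫₀¹ σ(p(y,t)) dy`. -/
noncomputable def meanStress (σ : ℝ → ℝ) (p : ℝ → ℝ → ℝ) (t : ℝ) : ℝ :=
  ∫ y, σ (p y t) ∂unitMeasure

/-- `p = p(x,t)` is a solution on `(0,1) × [0,T]` of
`p_t(x,t) = -σ(p(x,t)) + ∫₀¹ σ(p(y,t)) dy`, `p(x,0) = p₀(x)`, `∫₀¹ p(x,t) dx = μ`. -/
structure IsSolutionOn (σ : ℝ → ℝ) (μ : ℝ) (p₀ : ℝ → ℝ) (T : ℝ) (p : ℝ → ℝ → ℝ) : Prop where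
  aemeasurable : AEMeasurable (fun z : ℝ × ℝ => p z.1 z.2)
    (unitMeasure.prod (volume.restrict (Icc 0 T)))
  /-- `p(·,t) ∈ L²(0,1)` for every `t`, -/
  memLp : ∀ t ∈ Icc 0 T, MemLp (fun x => p x t) 2 unitMeasure
  /-- and `t ↦ p(·,t)` is continuous from `[0,T]` to `L²(0,1)`. -/
  continuous_L2 : ∀ t ∈ Icc 0 T,
    Tendsto (fun s => eLpNorm (fun x => p x s - p x t) 2 unitMeasure) (𝓝[Icc 0 T] t) (𝓝 0)
  initial : ∀ᵐ x ∂unitMeasure, p x 0 = p₀ x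
  pos : ∀ᵐ z ∂(unitMeasure.prod (volume.restrict (Icc 0 T))), 0 < p z.1 z.2
  integrable_stress : ∀ᵐ t ∂(volume.restrict (Icc 0 T)),
    Integrable (fun x => σ (p x t)) unitMeasure
  integrable_rate : ∀ᵐ x ∂unitMeasure, ∀ τ > 0,
    IntegrableOn (fun t => σ (p x t) - meanStress σ p t) (Ioo τ T) volume
  integral_eq : ∀ᵐ x ∂unitMeasure, ∀ s ∈ Ioc 0 T, ∀ t ∈ Ioc 0 T,
    p x t = p x s - ∫ τ in s..t, (σ (p x τ) - meanStress σ p τ)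
  mass : ∀ t ∈ Icc 0 T, ∫ x, p x t ∂unitMeasure = μ

/-- A solution for all times `t ≥ 0`. -/
def IsSolution (σ : ℝ → ℝ) (μ : ℝ) (p₀ : ℝ → ℝ) (p : ℝ → ℝ → ℝ) : Prop :=
  ∀ T > 0, IsSolutionOn σ μ p₀ T p

/-- The critical points of `σ` in `(0,∞)`. -/
def criticalSet (σ : ℝ → ℝ) : Set ℝ := {z | 0 < z ∧ deriv σ z = 0}

/-- `g₁, …, gₙ` are the distinct inverse functions of `σ` on `[α,β]`: they are continuous there,
and for each `c ∈ [α,β]` the values `gᵢ(c)` list the roots `z > 0` of `σ(z) = c`, each exactly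
once. -/
def IsInverseBranches (σ : ℝ → ℝ) (α β : ℝ) {n : ℕ} (g : Fin n → ℝ → ℝ) : Prop :=
  (∀ i, ContinuousOn (g i) (Icc α β)) ∧
    ∀ c ∈ Icc α β, BijOn (fun i => g i c) univ {z | 0 < z ∧ σ z = c}

/-- The nondegeneracy condition. Linear independence in `C⁰([α,β])` is the same as linear
independence in the space of all real functions on `[α,β]`. -/
structure Nondegenerate (σ : ℝ → ℝ) : Prop where
  contDiff : ContDiffOn ℝ 1 σ (Ioi 0)
  null_critical : volume (criticalSet σ) = 0
  linearIndependent : ∀ α β : ℝ, α < β → Disjoint (Icc α β) (σ '' criticalSet σ) →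
    ∀ (k : ℕ) (g : Fin (2 * k + 1) → ℝ → ℝ), IsInverseBranches σ α β g →
      LinearIndependent ℝ
        (fun i => fun c : Icc α β => derivWithin (g i) (Icc α β) (c : ℝ))

end QuasistaticVisco

/-! For almost every `x` the function `p(x,·)` solves one and the same scalar equation `u' = m(t) -
σ(u)`, with `m` the mean stress; points interact only through `m`. Hence trajectories stay ordered,
and since `1/σ` is integrable at infinity they come down from infinity in a time independent of the
starting value. With conservation of mass and `σ → -∞` at `0`, this confines the solution to a
compact interval `[ε, K]` of `(0,∞)` from some time on (`IsFlow.exists_upper_bound`,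
`IsFlow.exists_lower_bound`).

There `W(p)` is bounded, so the energy identity `d/dt ∫ W(p) = -∫ (σ(p) - m)²` makes the total
dissipation finite. As `σ(p(x,·)) - m` is Lipschitz in time, it tends to zero for almost every `x`
(`tendsto_stress_sub_meanStress`). This does not yet exclude a slow oscillation of `m`.

Suppose `m` oscillates (`exists_tendsto_meanStress`). By Sard, the values crossed infinitely often
include an interval free of critical values, over which `σ` has an odd number of inverse branches
`gᵢ`. During a late passage, all points outside a set of small measure stay on one branch each, so
the branch masses hardly depend on the value `c` of `m`, and their combination with the `gᵢ(c)` is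
close to `μ`. In the limit along a subsequence, `∑ Lᵢ gᵢ(c) = μ` for all `c` in an interval.
Differentiation and linear independence give `Lᵢ = 0`, hence `μ = 0`, which is absurd.

Once `m → C`, a level `a` with `σ(a) ≠ C` can be crossed only one way at late times. Such levels are
dense because the critical set is null, so `p(x,·)` converges; the limit is an equilibrium, and
dominated convergence gives convergence in `L²` (`exists_equilibrium_of_tendsto`). -/

namespace QuasistaticVisco

/-! ### Monotonicity, bounds and growth of the stress -/

section Stress

variable {σ : ℝ → ℝ}

theorem StressAssumptions.continuousOn (hσ : StressAssumptions σ) : ContinuousOn σ (Ioi 0) :=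
  hσ.locallyLipschitz.continuousOn

theorem StressAssumptions.exists_strictMonoOn_Ioo (hσ : StressAssumptions σ) :
    ∃ θ > 0, StrictMonoOn σ (Ioo 0 θ) := by
  obtain ⟨α, hα, θ, hθ, h⟩ := hσ.deriv_lower_bound
  refine ⟨θ, hθ, strictMonoOn_of_deriv_pos (convex_Ioo _ _)
    (hσ.continuousOn.mono Ioo_subset_Ioi_self) fun x hx => ?_⟩
  rw [interior_Ioo] at hx
  exact hα.trans_le (h x hx)

theorem exists_lipschitzOnWith_Icc (hC : ContDiffOn ℝ 1 σ (Ioi 0)) {a : ℝ} (ha : 0 < a) (b : ℝ) :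
    ∃ L, LipschitzOnWith L σ (Icc a b) :=
  (hC.mono fun _ hx => ha.trans_le hx.1).exists_lipschitzOnWith (by decide)
    (convex_Icc _ _) isCompact_Icc

/-- A stress satisfying the standing assumptions is one-sided Lipschitz on bounded intervals. -/
theorem StressAssumptions.exists_oneSided_lipschitz (hσ : StressAssumptions σ)
    (hC : ContDiffOn ℝ 1 σ (Ioi 0)) (K : ℝ) :
    ∃ L : ℝ, 0 ≤ L ∧ ∀ a b, 0 < b → b ≤ a → a ≤ K → σ b - σ a ≤ L * (a - b) := by
  obtain ⟨θ, hθ, hmono⟩ := hσ.exists_strictMonoOn_Ioo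
  obtain ⟨L, hL⟩ := exists_lipschitzOnWith_Icc hC (half_pos hθ) K
  have hlip : ∀ a b, θ / 2 ≤ b → b ≤ a → a ≤ K → σ b - σ a ≤ L * (a - b) := by
    intro a b hb hab ha
    have := hL.dist_le_mul b ⟨hb, hab.trans ha⟩ a ⟨hb.trans hab, ha⟩
    rw [Real.dist_eq, Real.dist_eq, abs_sub_comm b a, abs_of_nonneg (sub_nonneg.2 hab)] at this
    exact (le_abs_self _).trans this
  refine ⟨L, L.2, fun a b hb hab ha => ?_⟩
  have hL0 : (0 : ℝ) ≤ L := L.2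
  -- Near `0` the stress is not Lipschitz, but it increases there, which only helps the one-sided
  -- bound. Pairs that straddle the two regions are compared through `θ / 2`.
  rcases le_or_gt (θ / 2) b with h | h
  · exact hlip a b h hab ha
  rcases lt_or_ge a θ with h' | h'
  · have := hmono.monotoneOn ⟨hb, hab.trans_lt h'⟩ ⟨hb.trans_le hab, h'⟩ hab
    nlinarith [mul_nonneg hL0 (sub_nonneg.2 hab)]
  · have h1 := hmono.monotoneOn ⟨hb, by linarith⟩ ⟨half_pos hθ, by linarith⟩ h.le
    have h2 := hlip a (θ / 2) le_rfl (by linarith) ha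
    nlinarith [mul_nonneg hL0 (sub_nonneg.2 h.le)]

theorem StressAssumptions.exists_upper_bound (hσ : StressAssumptions σ) (K : ℝ) :
    ∃ S : ℝ, ∀ z, 0 < z → z ≤ K → σ z ≤ S := by
  obtain ⟨δ, hδ, h⟩ : ∃ δ > 0, ∀ z, 0 < z → z < δ → σ z ≤ 0 := by
    have := hσ.tendsto_zero.eventually_le_atBot 0
    rw [eventually_nhdsWithin_iff, Metric.eventually_nhds_iff] at this
    obtain ⟨δ, hδ, h⟩ := this
    refine ⟨δ, hδ, fun z hz hz' => h ?_ hz⟩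
    simpa [abs_of_pos hz] using hz'
  obtain ⟨S, hS⟩ := (isCompact_Icc (a := δ) (b := K)).bddAbove_image
    (hσ.continuousOn.mono fun x hx => hδ.trans_le hx.1)
  refine ⟨max S 0, fun z hz hzK => ?_⟩
  rcases lt_or_ge z δ with h' | h'
  · exact (h z hz h').trans (le_max_right _ _)
  · exact (hS ⟨z, ⟨h', hzK⟩, rfl⟩).trans (le_max_left _ _)

theorem hasDerivAt_storedEnergy (hc : ContinuousOn σ (Ioi 0)) {z : ℝ} (hz : 0 < z) :
    HasDerivAt (storedEnergy σ) (σ z) z := by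
  have hsub : uIcc 1 z ⊆ Ioi 0 := fun x hx => (lt_min one_pos hz).trans_le hx.1
  exact intervalIntegral.integral_hasDerivAt_right (hc.mono hsub).intervalIntegrable
    (hc.stronglyMeasurableAtFilter isOpen_Ioi _ hz) (hc.continuousAt (Ioi_mem_nhds hz))

/-- The stress is the derivative of `W`, and the derivative of a convex function is monotone. -/
theorem StressAssumptions.exists_monotoneOn_Ici (hσ : StressAssumptions σ) :
    ∃ M > 0, MonotoneOn σ (Ici M) := by
  obtain ⟨M, hM, h⟩ := hσ.strictConvex_large
  have hd : ∀ z ∈ Ici M, HasDerivAt (storedEnergy σ) (σ z) z := fun z hz =>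
    hasDerivAt_storedEnergy hσ.continuousOn (hM.trans_le hz)
  refine ⟨M, hM, (h.convexOn.monotoneOn_deriv fun z hz => (hd z hz).differentiableAt).congr
    fun z hz => (hd z hz).deriv⟩

/-- Far out the stress is positive and nondecreasing, with integrable reciprocal. -/
theorem StressAssumptions.exists_tail (hσ : StressAssumptions σ) :
    ∃ M > 0, MonotoneOn σ (Ici M) ∧ 0 < σ M ∧ IntegrableOn (fun z => 1 / σ z) (Ioi M) := by
  obtain ⟨M, hM, hmono⟩ := hσ.exists_monotoneOn_Ici
  obtain ⟨P, -, hint⟩ := hσ.integrable_inv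
  obtain ⟨N, hN, hNM⟩ := (hσ.pos_large.and (eventually_ge_atTop (max M (P + 1)))).exists
  exact ⟨N, hM.trans_le ((le_max_left _ _).trans hNM),
    hmono.mono (Ici_subset_Ici.2 ((le_max_left _ _).trans hNM)), hN,
    hint.mono_set (Ioi_subset_Ioi ((le_max_right _ _).trans hNM))⟩

/-- A bound `σ ≤ B` on the monotone tail would keep `1/σ ≥ 1/B` on a half-line, against
integrability. -/
theorem StressAssumptions.tendsto_atTop (hσ : StressAssumptions σ) : Tendsto σ atTop atTop := by
  obtain ⟨M, hM, hmono, hpos, hint⟩ := hσ.exists_tail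
  rw [tendsto_atTop_atTop]
  by_contra! hcon
  obtain ⟨B, hB⟩ := hcon
  have hbd : ∀ z ∈ Ioi M, σ z ≤ B := fun z hz => by
    obtain ⟨w, hw, hw'⟩ := hB z
    exact (hmono (mem_Ici.2 (le_of_lt hz)) (mem_Ici.2 ((le_of_lt hz).trans hw)) hw).trans hw'.le
  have hpos' : ∀ z ∈ Ioi M, 0 < σ z := fun z hz =>
    hpos.trans_le (hmono self_mem_Ici (mem_Ici.2 (le_of_lt hz)) (le_of_lt hz))
  have hconst : IntegrableOn (fun _ : ℝ => 1 / B) (Ioi M) := by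
    refine hint.mono' aestronglyMeasurable_const ?_
    filter_upwards [ae_restrict_mem measurableSet_Ioi] with z hz
    have h1 := hpos' z hz
    rw [Real.norm_of_nonneg (one_div_nonneg.2 (h1.le.trans (hbd z hz)))]
    exact one_div_le_one_div_of_le h1 (hbd z hz)
  rw [integrableOn_const_iff] at hconst
  have hB0 : 0 < B := (hpos' (M + 1) (by simp)).trans_le (hbd _ (by simp))
  rcases hconst with h | h
  · simp [hB0.ne'] at h
  · simp at h

/-- A threshold beyond which the stress dominates a given constant `S`. -/
theorem StressAssumptions.exists_threshold (hσ : StressAssumptions σ) (S : ℝ) :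
    ∃ D > 0, MonotoneOn σ (Ici D) ∧ 0 < σ D ∧ IntegrableOn (fun z => 1 / σ z) (Ioi D) ∧
      ∀ z, D ≤ z → S + σ z / 2 ≤ σ z := by
  obtain ⟨M, hM, hmono, hpos, hint⟩ := hσ.exists_tail
  obtain ⟨D, hD⟩ := eventually_atTop.1 (hσ.tendsto_atTop.eventually_ge_atTop (max (2 * S) 1))
  refine ⟨max M D, hM.trans_le (le_max_left _ _),
    hmono.mono (Ici_subset_Ici.2 (le_max_left _ _)),
    one_pos.trans_le ((le_max_right _ _).trans (hD _ (le_max_right _ _))),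
    hint.mono_set (Ioi_subset_Ioi (le_max_left _ _)), fun z hz => ?_⟩
  have := (le_max_left _ _).trans (hD z ((le_max_right _ _).trans hz))
  linarith

/-- All sufficiently small levels `c` separate the stress: below `c` it is smaller than `σ c`,
between `c` and `K` it is larger, and between `a` and `K` it is larger by at least one. -/
theorem StressAssumptions.exists_low_level (hσ : StressAssumptions σ) {a : ℝ} (ha : 0 < a) (K : ℝ) :
    ∃ e > 0, e ≤ a ∧ ∀ c, 0 < c → c ≤ e →
      (∀ z, 0 < z → z ≤ c → σ z ≤ σ c) ∧ (∀ z, c ≤ z → z ≤ K → σ c ≤ σ z) ∧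
        ∀ z, a ≤ z → z ≤ K → σ c + 1 ≤ σ z := by
  obtain ⟨θ, hθ, hmono⟩ := hσ.exists_strictMonoOn_Ioo
  set b := min a (θ / 2) with hb
  have hb0 : 0 < b := lt_min ha (half_pos hθ)
  obtain ⟨B, hB⟩ := (isCompact_Icc (a := b) (b := K)).bddBelow_image
    (hσ.continuousOn.mono fun x hx => hb0.trans_le hx.1)
  -- `B` bounds `σ` below on `[b, K]`. Once `σ c ≤ B - 1`, that interval satisfies both comparisons
  -- with a gap of one; on `(0, b]` monotonicity does the rest.
  have := hσ.tendsto_zero.eventually_le_atBot (B - 1)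
  rw [eventually_nhdsWithin_iff, Metric.eventually_nhds_iff] at this
  obtain ⟨δ, hδ, h⟩ := this
  refine ⟨min b (δ / 2), lt_min hb0 (half_pos hδ), (min_le_left _ _).trans (min_le_left _ _),
    fun c hc hce => ?_⟩
  have hcb : c ≤ b := hce.trans (min_le_left _ _)
  have hbθ : b < θ := (min_le_right _ _).trans_lt (half_lt_self hθ)
  have hcB : σ c ≤ B - 1 := by
    refine h ?_ hc
    rw [Real.dist_eq, sub_zero, abs_of_pos hc]
    exact (hce.trans (min_le_right _ _)).trans_lt (half_lt_self hδ)
  have hbig : ∀ z, b ≤ z → z ≤ K → B ≤ σ z := fun z h1 h2 => hB ⟨z, ⟨h1, h2⟩, rfl⟩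
  refine ⟨fun z hz hzc => ?_, fun z hz hzK => ?_, fun z hz hzK => ?_⟩
  · exact hmono.monotoneOn ⟨hz, by linarith⟩ ⟨hc, by linarith⟩ hzc
  · rcases lt_or_ge z b with hzb | hzb
    · exact hmono.monotoneOn ⟨hc, by linarith⟩ ⟨by linarith, by linarith⟩ hz
    · linarith [hbig z hzb hzK]
  · linarith [hbig z ((min_le_left _ _).trans hz) hzK]

end Stress

end QuasistaticVisco

/-! ### Absolutely continuous functions and differential inequalities -/

theorem LipschitzOnWith.comp_absolutelyContinuousOnInterval {φ f : ℝ → ℝ} {K : NNReal} {s : Set ℝ}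
    {a b : ℝ} (hφ : LipschitzOnWith K φ s) (hf : AbsolutelyContinuousOnInterval f a b)
    (hs : MapsTo f (uIcc a b) s) : AbsolutelyContinuousOnInterval (φ ∘ f) a b := by
  rw [absolutelyContinuousOnInterval_iff] at hf ⊢
  intro ε hε
  obtain ⟨δ, hδ, h⟩ := hf (ε / (K + 1)) (by positivity)
  refine ⟨δ, hδ, fun E hE hlen => ?_⟩
  have h1 := h E hE hlen
  calc ∑ i ∈ Finset.range E.1, dist ((φ ∘ f) (E.2 i).1) ((φ ∘ f) (E.2 i).2)
      ≤ ∑ i ∈ Finset.range E.1, K * dist (f (E.2 i).1) (f (E.2 i).2) :=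
        Finset.sum_le_sum fun i hi => hφ.dist_le_mul _ (hs (hE.1 i hi).1) _ (hs (hE.1 i hi).2)
    _ = K * ∑ i ∈ Finset.range E.1, dist (f (E.2 i).1) (f (E.2 i).2) := by rw [Finset.mul_sum]
    _ ≤ K * (ε / (K + 1)) := by gcongr
    _ < (K + 1) * (ε / (K + 1)) := by gcongr; linarith
    _ = ε := by field

theorem AbsolutelyContinuousOnInterval.max_zero {f : ℝ → ℝ} {a b : ℝ}
    (hf : AbsolutelyContinuousOnInterval f a b) :
    AbsolutelyContinuousOnInterval (fun t => max (f t) 0) a b := by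
  have hl : LipschitzOnWith 1 (fun z : ℝ => max z 0) univ := by
    refine LipschitzOnWith.of_dist_le_mul fun x _ y _ => ?_
    simpa [Real.dist_eq] using abs_max_sub_max_le_abs x y 0
  exact hl.comp_absolutelyContinuousOnInterval hf (mapsTo_univ _ _)

theorem deriv_max_zero_of_pos {f : ℝ → ℝ} {t : ℝ} (hc : ContinuousAt f t) (h : 0 < f t) :
    (fun s => max (f s) 0) =ᶠ[𝓝 t] f := by
  filter_upwards [hc.eventually (lt_mem_nhds h)] with s hs
  exact max_eq_left (le_of_lt hs)

theorem AbsolutelyContinuousOnInterval.ae_hasDerivAt {f : ℝ → ℝ} {a b : ℝ}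
    (hf : AbsolutelyContinuousOnInterval f a b) :
    ∀ᵐ t, t ∈ uIcc a b → HasDerivAt f (deriv f t) t := by
  filter_upwards [hf.ae_differentiableAt] with t ht htm
  exact (ht htm).hasDerivAt

/-- A differential inequality `f' ≤ L f` on the set where `f > 0` keeps `f` nonpositive. -/
theorem AbsolutelyContinuousOnInterval.nonpos_of_deriv_le {f : ℝ → ℝ} {a b L : ℝ} (hab : a ≤ b)
    (hf : AbsolutelyContinuousOnInterval f a b)
    (hd : ∀ᵐ t, t ∈ Icc a b → 0 < f t → deriv f t ≤ L * f t) (ha : f a ≤ 0) : f b ≤ 0 := by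
  set h : ℝ → ℝ := fun t => max (f t) 0 * Real.exp (-L * t) with hh
  have hexp : AbsolutelyContinuousOnInterval (fun t => Real.exp (-L * t)) a b :=
    ContDiffOn.absolutelyContinuousOnInterval
      (Real.contDiff_exp.comp (contDiff_const.mul contDiff_id)).contDiffOn
  have hAC : AbsolutelyContinuousOnInterval h a b := hf.max_zero.mul hexp
  have hnn : ∀ t, 0 ≤ h t := fun t => mul_nonneg (le_max_right _ _) (Real.exp_pos _).le
  have hint : ∫ t in a..b, deriv h t ≤ 0 := by
    rw [intervalIntegral.integral_of_le hab]
    refine integral_nonpos_of_ae ?_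
    rw [EventuallyLE, ae_restrict_iff' measurableSet_Ioc]
    filter_upwards [hd, hf.ae_hasDerivAt] with t h1 h2 htm
    have htm' : t ∈ Icc a b := Ioc_subset_Icc_self htm
    rcases lt_or_ge 0 (f t) with hp | hp
    · have hft := h2 (by rwa [uIcc_of_le hab])
      have hE : HasDerivAt (fun t => Real.exp (-L * t)) (Real.exp (-L * t) * (-L)) t := by
        simpa using ((hasDerivAt_id t).const_mul (-L)).exp
      have hm : HasDerivAt (fun s => max (f s) 0) (deriv f t) t :=
        hft.congr_of_eventuallyEq (deriv_max_zero_of_pos hft.continuousAt hp)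
      rw [hh, (hm.fun_mul hE).deriv, max_eq_left hp.le]
      have := h1 htm' hp
      have he := Real.exp_pos (-L * t)
      simp only [Pi.zero_apply]
      nlinarith
    -- Where `f ≤ 0`, `h` attains its global minimum `0`, so `deriv h t = 0` whether or not `h` is
    -- differentiable there.
    · have : IsLocalMin h t := by
        refine Eventually.of_forall fun s => ?_
        have : h t = 0 := by simp [hh, max_eq_right hp]
        rw [this]; exact hnn s
      rw [this.deriv_eq_zero]; rfl
  rw [hAC.integral_deriv_eq_sub] at hint
  have h0 : h a = 0 := by simp [hh, max_eq_right ha]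
  have hb : h b = 0 := le_antisymm (by linarith) (hnn b)
  rcases mul_eq_zero.1 hb with h' | h'
  · exact max_eq_right_iff.1 h'
  · exact absurd h' (Real.exp_pos _).ne'

/-- The fundamental theorem of calculus for the positive part. -/
theorem max_zero_eq_add_integral {f g : ℝ → ℝ} {a b : ℝ} (hab : a ≤ b)
    (hf : AbsolutelyContinuousOnInterval f a b)
    (hfg : ∀ᵐ t, t ∈ Icc a b → HasDerivAt f (g t) t) :
    max (f b) 0 = max (f a) 0 + ∫ t in a..b, {t | 0 < f t}.indicator g t := by
  rw [← sub_eq_iff_eq_add', ← hf.max_zero.integral_deriv_eq_sub]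
  refine intervalIntegral.integral_congr_ae ?_
  filter_upwards [hfg] with t ht htm
  rw [uIoc_of_le hab] at htm
  have hft := ht (Ioc_subset_Icc_self htm)
  rcases lt_or_ge 0 (f t) with hp | hp
  · rw [indicator_of_mem (by exact hp),
      (hft.congr_of_eventuallyEq (deriv_max_zero_of_pos hft.continuousAt hp)).deriv]
  · rw [indicator_of_notMem (by simpa using hp)]
    have : IsLocalMin (fun t => max (f t) 0) t :=
      Eventually.of_forall fun s => by simp [max_eq_right hp]
    exact this.deriv_eq_zero

theorem absolutelyContinuousOnInterval_of_integral_eq {f g : ℝ → ℝ} {a b : ℝ}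
    (hg : IntervalIntegrable g volume a b) (hab : a ≤ b)
    (h : ∀ t ∈ Icc a b, f t = f a + ∫ τ in a..t, g τ) :
    AbsolutelyContinuousOnInterval f a b ∧
      ∀ᵐ t, t ∈ Icc a b → HasDerivAt f (g t) t := by
  have hG : AbsolutelyContinuousOnInterval (fun t => f a + ∫ τ in a..t, g τ) a b :=
    (LipschitzOnWith.absolutelyContinuousOnInterval (K := 0)
      ((LipschitzWith.const (f a)).lipschitzOnWith)).add
      (hg.absolutelyContinuousOnInterval_intervalIntegral left_mem_uIcc)
  have hAC : AbsolutelyContinuousOnInterval f a b := by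
    rw [absolutelyContinuousOnInterval_iff] at hG ⊢
    intro ε hε
    obtain ⟨δ, hδ, hd⟩ := hG ε hε
    refine ⟨δ, hδ, fun E hE hlen => lt_of_eq_of_lt (Finset.sum_congr rfl fun i hi => ?_)
      (hd E hE hlen)⟩
    have h1 := hE.1 i hi
    rw [uIcc_of_le hab] at h1
    rw [h _ h1.1, h _ h1.2]
  refine ⟨hAC, ?_⟩
  -- The integral formula holds on `[a,b]` only, so it determines a two-sided derivative only in the
  -- interior; the endpoints are discarded.
  have hne : ∀ c : ℝ, ∀ᵐ t : ℝ, t ≠ c := fun c => by simp [ae_iff, measure_singleton]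
  filter_upwards [hg.ae_hasDerivAt_integral, hne a, hne b] with t ht hta htb htm
  have htm' : t ∈ Ioo a b := ⟨lt_of_le_of_ne htm.1 hta.symm, lt_of_le_of_ne htm.2 htb⟩
  have := (ht (by rwa [uIcc_of_le hab]) a left_mem_uIcc).const_add (f a)
  refine this.congr_of_eventuallyEq ?_
  filter_upwards [Ioo_mem_nhds htm'.1 htm'.2] with s hs
  exact h s (Ioo_subset_Icc_self hs)

/-! ### Scalar trajectories with common forcing -/

namespace QuasistaticVisco

/-- An integral curve of `u' = m(t) - σ(u)` on `[1,∞)`, positive at almost all times. -/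
structure IsTrajectory (σ m u : ℝ → ℝ) : Prop where
  integrable : ∀ s t, 1 ≤ s → s ≤ t → IntervalIntegrable (fun τ => σ (u τ) - m τ) volume s t
  integral_eq : ∀ s t, 1 ≤ s → s ≤ t → u t = u s - ∫ τ in s..t, (σ (u τ) - m τ)
  pos : ∀ᵐ t, 1 ≤ t → 0 < u t

namespace IsTrajectory

variable {σ m u v : ℝ → ℝ}

theorem ac (hu : IsTrajectory σ m u) {s t : ℝ} (hs : 1 ≤ s) (hst : s ≤ t) :
    AbsolutelyContinuousOnInterval u s t ∧
      ∀ᵐ τ, τ ∈ Icc s t → HasDerivAt u (m τ - σ (u τ)) τ := by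
  refine absolutelyContinuousOnInterval_of_integral_eq (g := fun τ => m τ - σ (u τ)) ?_ hst
    fun r hr => ?_
  · exact (hu.integrable s t hs hst).neg.congr (fun τ _ => by simp)
  · rw [hu.integral_eq s r hs hr.1, sub_eq_add_neg, ← intervalIntegral.integral_neg]
    simp

theorem continuousOn (hu : IsTrajectory σ m u) : ContinuousOn u (Ici 1) := by
  intro t ht
  have hc := (hu.ac le_rfl (show (1 : ℝ) ≤ t + 1 by linarith [mem_Ici.1 ht])).1.continuousOn
  rw [uIcc_of_le (by linarith [mem_Ici.1 ht])] at hc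
  refine (hc t ⟨ht, by linarith⟩).mono_of_mem_nhdsWithin ?_
  rw [mem_nhdsWithin]
  exact ⟨Iio (t + 1), isOpen_Iio, by simp, fun x hx => ⟨hx.2, le_of_lt hx.1⟩⟩

/-- Positivity is given at almost all times only; by continuity a negative value would persist on an
interval of positive length. -/
theorem nonneg (hu : IsTrajectory σ m u) {t : ℝ} (ht : 1 ≤ t) : 0 ≤ u t := by
  by_contra! hneg
  have h1 : ∀ᶠ s in 𝓝[>] t, u s < 0 :=
    ((hu.continuousOn t ht).mono_left (nhdsWithin_mono _ fun s hs => ht.trans (le_of_lt hs)))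
      |>.eventually (gt_mem_nhds hneg)
  obtain ⟨w, hw, hw'⟩ := mem_nhdsGT_iff_exists_Ioo_subset.1 h1
  have h0 : volume (Ioo t w) = 0 := by
    refine measure_mono_null (fun s hs => ?_) (ae_iff.1 hu.pos)
    have : u s < 0 := hw' hs
    simp only [mem_ofPred_eq, Classical.not_imp, not_lt]
    exact ⟨ht.trans hs.1.le, this.le⟩
  rw [Real.volume_Ioo, ENNReal.ofReal_eq_zero] at h0
  linarith [mem_Ioi.1 hw]

/-- The difference of two trajectories for the same forcing. -/
theorem sub_ac (hu : IsTrajectory σ m u) (hv : IsTrajectory σ m v) {s t : ℝ} (hs : 1 ≤ s)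
    (hst : s ≤ t) : AbsolutelyContinuousOnInterval (fun τ => u τ - v τ) s t ∧
      ∀ᵐ τ, τ ∈ Icc s t → deriv (fun τ => u τ - v τ) τ = σ (v τ) - σ (u τ) := by
  refine ⟨(hu.ac hs hst).1.sub (hv.ac hs hst).1, ?_⟩
  filter_upwards [(hu.ac hs hst).2, (hv.ac hs hst).2] with τ h1 h2 hτ
  rw [((h1 hτ).fun_sub (h2 hτ)).deriv]
  ring

theorem exists_bound (hu : IsTrajectory σ m u) (s t : ℝ) (hs : 1 ≤ s) :
    ∃ K, ∀ τ ∈ Icc s t, u τ ≤ K := by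
  obtain ⟨K, hK⟩ := (isCompact_Icc (a := s) (b := t)).bddAbove_image
    (hu.continuousOn.mono fun x hx => hs.trans hx.1)
  exact ⟨K, fun τ hτ => hK ⟨τ, hτ, rfl⟩⟩

/-- Trajectories for the same forcing stay ordered. -/
theorem le_of_le (hσ : StressAssumptions σ) (hC : ContDiffOn ℝ 1 σ (Ioi 0))
    (hu : IsTrajectory σ m u) (hv : IsTrajectory σ m v) {s t : ℝ} (hs : 1 ≤ s) (hst : s ≤ t)
    (h : u s ≤ v s) : u t ≤ v t := by
  obtain ⟨K, hK⟩ := hu.exists_bound s t hs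
  -- The estimate `σ(v) - σ(u) ≤ L (u - v)` is needed only where `u > v`, so a one-sided constant
  -- suffices, however close `v` comes to `0`.
  obtain ⟨L, -, hL⟩ := hσ.exists_oneSided_lipschitz hC K
  obtain ⟨h1, h2⟩ := hu.sub_ac hv hs hst
  have := h1.nonpos_of_deriv_le (L := L) hst ?_ (by linarith)
  · linarith
  filter_upwards [h2, hv.pos] with τ hd hpos hτ hlt
  rw [hd hτ]
  exact hL _ _ (hpos (hs.trans hτ.1)) (by linarith) (hK τ hτ)

/-- Trajectories come down from infinity in a uniform time: a bound on one trajectory yields, after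
a waiting time, a bound on every trajectory for the same forcing. -/
theorem exists_uniform_bound (hσ : StressAssumptions σ) (Y : ℝ) :
    ∃ K T : ℝ, 1 ≤ T ∧ ∀ m u v : ℝ → ℝ, IsTrajectory σ m u → IsTrajectory σ m v →
      (∀ t, 1 ≤ t → v t ≤ Y) → ∀ t, T ≤ t → u t ≤ K := by
  -- Let `w = u - v`. While `w ≥ D`, `w' = σ(v) - σ(u) ≤ S - σ(u) ≤ -σ(u)/2 ≤ -σ(w)/2`, so `H(w)`
  -- with `H' = 1/σ` falls at rate at least `1/2`. But `0 ≤ H ≤ I` there, so this lasts for a time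
  -- at most `2 I`.
  obtain ⟨S, hS⟩ := hσ.exists_upper_bound Y
  obtain ⟨D, hD, hmono, hDpos, hint, hhalf⟩ := hσ.exists_threshold S
  have hσpos : ∀ z, D ≤ z → 0 < σ z := fun z hz =>
    hDpos.trans_le (hmono self_mem_Ici hz hz)
  -- Freezing the argument below `D` makes `H` globally `C¹` and Lipschitz, so that `H ∘ w` is
  -- absolutely continuous.
  set φ : ℝ → ℝ := fun w => 1 / σ (max w D) with hφ
  have hφc : Continuous φ := by
    refine continuous_const.div (hσ.continuousOn.comp_continuous
      (continuous_id.max continuous_const) fun w => hD.trans_le (le_max_right _ _)) fun w =>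
      (hσpos _ (le_max_right _ _)).ne'
  have hφ0 : ∀ w, 0 ≤ φ w := fun w => one_div_nonneg.2 (hσpos _ (le_max_right _ _)).le
  set H : ℝ → ℝ := fun z => ∫ w in D..z, φ w with hH
  have hHd : ∀ z, HasDerivAt H (φ z) z := fun z =>
    intervalIntegral.integral_hasDerivAt_right (hφc.intervalIntegrable _ _)
      hφc.stronglyMeasurable.stronglyMeasurableAtFilter hφc.continuousAt
  have hHlip : LipschitzWith (1 / σ D).toNNReal H := by
    refine lipschitzWith_of_nnnorm_deriv_le (fun z => (hHd z).differentiableAt) fun z => ?_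
    rw [(hHd z).deriv, ← NNReal.coe_le_coe, coe_nnnorm, Real.norm_of_nonneg (hφ0 z),
      Real.coe_toNNReal _ (one_div_nonneg.2 hDpos.le)]
    exact one_div_le_one_div_of_le hDpos (hmono self_mem_Ici (le_max_right z D) (le_max_right z D))
  set I : ℝ := ∫ z in Ioi D, 1 / σ z with hI
  have hHI : ∀ z, D ≤ z → H z ≤ I := fun z hz => by
    rw [hH, hI]
    simp only
    rw [intervalIntegral.integral_of_le hz]
    have hcongr : ∫ w in Ioc D z, φ w = ∫ w in Ioc D z, 1 / σ w :=
      setIntegral_congr_fun measurableSet_Ioc fun w hw => by simp [hφ, max_eq_left hw.1.le]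
    rw [hcongr]
    refine setIntegral_mono_set hint ?_ (Ioc_subset_Ioi_self).eventuallyLE
    filter_upwards [ae_restrict_mem measurableSet_Ioi] with w hw
    exact one_div_nonneg.2 (hσpos w (le_of_lt hw)).le
  have hH0 : ∀ z, D ≤ z → 0 ≤ H z := fun z hz =>
    intervalIntegral.integral_nonneg hz fun w _ => hφ0 w
  have hI0 : 0 ≤ I := (hH0 D le_rfl).trans (hHI D le_rfl)
  refine ⟨Y + D, 2 + 2 * I, by linarith, fun m u v hu hv hY t ht => ?_⟩
  by_contra! hcon
  have h1t : (1 : ℝ) ≤ t := by linarith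
  -- Since `w` decreases above `D`, once at or below `D` it stays there, which would give `u t ≤ Y +
  -- D`.
  have hbig : ∀ s ∈ Icc 1 t, D < u s - v s := by
    intro s hs
    by_contra! hle
    obtain ⟨hac, hd⟩ := hu.sub_ac hv hs.1 hs.2
    have hcst : AbsolutelyContinuousOnInterval (fun _ : ℝ => D) s t :=
      LipschitzOnWith.absolutelyContinuousOnInterval (K := 0)
        (LipschitzWith.const D).lipschitzOnWith
    have := (hac.sub hcst).nonpos_of_deriv_le (L := 0) hs.2 ?_ (by simpa using hle)
    · simp only [Pi.sub_apply] at this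
      linarith [hY t h1t]
    filter_upwards [hd, hv.pos] with τ h1 h2 hτ hpos
    have hτ1 : 1 ≤ τ := hs.1.trans hτ.1
    have hvp := h2 hτ1
    have hder : deriv ((fun τ => u τ - v τ) - fun _ => D) τ = σ (v τ) - σ (u τ) := by
      rw [← h1 hτ]
      exact deriv_sub_const (f := fun τ => u τ - v τ) D
    rw [hder, zero_mul]
    simp only [Pi.sub_apply] at hpos
    have hDu : D ≤ u τ := by linarith
    linarith [hS _ hvp (hY τ hτ1), hhalf _ hDu, hσpos _ hDu]
  obtain ⟨hac, -⟩ := hu.sub_ac hv le_rfl h1t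
  have hG := hHlip.lipschitzOnWith (s := univ).comp_absolutelyContinuousOnInterval hac
    (mapsTo_univ _ _)
  have hbound : ∫ s in (1 : ℝ)..t, deriv (H ∘ fun τ => u τ - v τ) s ≤
      ∫ _s in (1 : ℝ)..t, -(1 / 2 : ℝ) := by
    refine intervalIntegral.integral_mono_ae_restrict h1t hG.intervalIntegrable_deriv
      intervalIntegrable_const ?_
    rw [EventuallyLE, ae_restrict_iff' measurableSet_Icc]
    filter_upwards [(hu.ac le_rfl h1t).2, (hv.ac le_rfl h1t).2, hv.pos] with s h1 h2 h3 hs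
    have hD' := hbig s hs
    have hvp := h3 hs.1
    have hder := (hHd (u s - v s)).comp s ((h1 hs).fun_sub (h2 hs))
    rw [hder.deriv]
    have e1 : σ (u s - v s) ≤ σ (u s) :=
      hmono (mem_Ici.2 hD'.le) (mem_Ici.2 (by linarith)) (by linarith)
    have e2 := hS _ hvp (hY s hs.1)
    have e3 := hhalf (u s) (by linarith)
    have e4 := hσpos _ hD'.le
    rw [hφ]
    simp only
    rw [max_eq_left hD'.le, one_div, inv_mul_le_iff₀ e4]
    linarith
  rw [hG.integral_deriv_eq_sub, intervalIntegral.integral_const, smul_eq_mul] at hbound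
  have e1 := hH0 _ (hbig t ⟨h1t, le_rfl⟩).le
  have e2 := hHI _ (hbig 1 ⟨le_rfl, h1t⟩).le
  simp only [Function.comp_apply] at hbound
  linarith

end IsTrajectory

end QuasistaticVisco

/-! ### Solutions as families of trajectories; the upper bound -/

namespace QuasistaticVisco

instance : IsProbabilityMeasure unitMeasure :=
  ⟨by simp [unitMeasure]⟩

/-- The properties of a solution on the time interval `[1,∞)`, away from the initial datum. -/
structure IsFlow (σ : ℝ → ℝ) (μ : ℝ) (p : ℝ → ℝ → ℝ) : Prop where
  trajectory : ∀ᵐ x ∂unitMeasure, IsTrajectory σ (meanStress σ p) (p x)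
  memLp : ∀ t, 1 ≤ t → MemLp (fun x => p x t) 2 unitMeasure
  mass : ∀ t, 1 ≤ t → ∫ x, p x t ∂unitMeasure = μ
  aemeasurable : ∀ s t, 1 ≤ s → AEMeasurable (fun z : ℝ × ℝ => p z.1 z.2)
    (unitMeasure.prod (volume.restrict (Icc s t)))
  pos : ∀ s t, 1 ≤ s → ∀ᵐ z ∂(unitMeasure.prod (volume.restrict (Icc s t))), 0 < p z.1 z.2
  integrable_stress : ∀ᵐ t, 1 ≤ t → Integrable (fun x => σ (p x t)) unitMeasure

variable {σ : ℝ → ℝ} {μ : ℝ} {p₀ : ℝ → ℝ} {p : ℝ → ℝ → ℝ}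

/-- The integral identity starts at positive times, hence the restriction to `t ≥ 1`. Countably many
horizons `n + 1` suffice, so the exceptional null sets can be united. -/
theorem IsSolution.isFlow (hp : IsSolution σ μ p₀ p) : IsFlow σ μ p := by
  have hT : ∀ n : ℕ, IsSolutionOn σ μ p₀ ((n : ℝ) + 1) p := fun n => hp _ (by positivity)
  have hac : ∀ s t : ℝ, 1 ≤ s → ∀ n : ℕ, t ≤ (n : ℝ) + 1 →
      unitMeasure.prod (volume.restrict (Icc s t)) ≪
        unitMeasure.prod (volume.restrict (Icc 0 ((n : ℝ) + 1))) := fun s t hs n hn =>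
    (Measure.prod_mono le_rfl (Measure.restrict_mono
      (Icc_subset_Icc (by linarith) hn) le_rfl)).absolutelyContinuous
  refine ⟨?_, ?_, ?_, ?_, ?_, ?_⟩
  · have hpos : ∀ᵐ x ∂unitMeasure, ∀ n : ℕ, ∀ᵐ t ∂(volume.restrict (Icc 0 ((n : ℝ) + 1))),
        0 < p x t := ae_all_iff.2 fun n => Measure.ae_ae_of_ae_prod (hT n).pos
    filter_upwards [hpos, ae_all_iff.2 fun n => (hT n).integrable_rate,
      ae_all_iff.2 fun n => (hT n).integral_eq] with x h1 h2 h3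
    refine ⟨fun s t hs hst => ?_, fun s t hs hst => ?_, ?_⟩
    · obtain ⟨n, hn⟩ := exists_nat_ge t
      rw [intervalIntegrable_iff_integrableOn_Ioc_of_le hst]
      exact (h2 n (1 / 2) (by norm_num)).mono_set fun r hr =>
        ⟨by linarith [hr.1], by linarith [hr.2]⟩
    · obtain ⟨n, hn⟩ := exists_nat_ge t
      exact h3 n s ⟨by linarith, by linarith⟩ t ⟨by linarith, by linarith⟩
    · have : ∀ᵐ t : ℝ, ∀ n : ℕ, t ∈ Icc 0 ((n : ℝ) + 1) → 0 < p x t :=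
        ae_all_iff.2 fun n => (ae_restrict_iff' measurableSet_Icc).1 (h1 n)
      filter_upwards [this] with t ht ht1
      obtain ⟨n, hn⟩ := exists_nat_ge t
      exact ht n ⟨by linarith, by linarith⟩
  · intro t ht
    obtain ⟨n, hn⟩ := exists_nat_ge t
    exact (hT n).memLp t ⟨by linarith, by linarith⟩
  · intro t ht
    obtain ⟨n, hn⟩ := exists_nat_ge t
    exact (hT n).mass t ⟨by linarith, by linarith⟩
  · intro s t hs
    obtain ⟨n, hn⟩ := exists_nat_ge t
    exact (hT n).aemeasurable.mono_ac (hac s t hs n (by linarith))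
  · intro s t hs
    obtain ⟨n, hn⟩ := exists_nat_ge t
    exact (hac s t hs n (by linarith)).ae_le (hT n).pos
  · have : ∀ᵐ t : ℝ, ∀ n : ℕ, t ∈ Icc 0 ((n : ℝ) + 1) →
        Integrable (fun x => σ (p x t)) unitMeasure :=
      ae_all_iff.2 fun n => (ae_restrict_iff' measurableSet_Icc).1 (hT n).integrable_stress
    filter_upwards [this] with t ht ht1
    obtain ⟨n, hn⟩ := exists_nat_ge t
    exact ht n ⟨by linarith, by linarith⟩

namespace IsFlow

theorem integrable (hp : IsFlow σ μ p) {t : ℝ} (ht : 1 ≤ t) :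
    Integrable (fun x => p x t) unitMeasure :=
  (hp.memLp t ht).integrable (by norm_num)

theorem nonneg (hp : IsFlow σ μ p) {t : ℝ} (ht : 1 ≤ t) : ∀ᵐ x ∂unitMeasure, 0 ≤ p x t := by
  filter_upwards [hp.trajectory] with x hx using hx.nonneg ht

/-- After some time the solution is bounded above. -/
theorem exists_upper_bound (hσ : StressAssumptions σ) (hC : ContDiffOn ℝ 1 σ (Ioi 0))
    (hp : IsFlow σ μ p) : ∃ K T : ℝ, 1 ≤ T ∧ ∀ᵐ x ∂unitMeasure, ∀ t, T ≤ t → p x t ≤ K := by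
  have hint := hp.integrable le_rfl
  have h1 := measure_le_integral_pos hint
  have h2 := measure_integral_le_pos hint
  -- A reference trajectory starting at or below the mean. The points starting at or above the mean,
  -- a set of measure `δ > 0`, stay above it, so conservation of mass keeps it below `μ / δ`.
  obtain ⟨y, hyt, hy⟩ : ∃ y, IsTrajectory σ (meanStress σ p) (p y) ∧
      p y 1 ≤ ∫ x, p x 1 ∂unitMeasure := by
    by_contra! hcon
    refine h1.ne' (measure_mono_null (fun x hx => ?_) (ae_iff.1 hp.trajectory))
    exact fun hx' => absurd hx (not_le.2 (hcon x hx'))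
  set δ := unitMeasure.real {x | ∫ a, p a 1 ∂unitMeasure ≤ p x 1} with hδ
  have hδ0 : 0 < δ := ENNReal.toReal_pos h2.ne' (measure_ne_top _ _)
  have hY : ∀ t, 1 ≤ t → p y t ≤ μ / δ := by
    intro t ht
    have hm := mul_meas_ge_le_integral_of_nonneg (hp.nonneg ht) (hp.integrable ht) (p y t)
    rw [hp.mass t ht] at hm
    rw [le_div_iff₀ hδ0]
    refine le_trans (mul_le_mul_of_nonneg_left ?_ (hyt.nonneg ht)) hm
    refine ENNReal.toReal_mono (measure_ne_top _ _) (measure_mono_ae ?_)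
    filter_upwards [hp.trajectory] with x hx hmem
    exact hyt.le_of_le hσ hC hx le_rfl ht (hy.trans hmem)
  obtain ⟨K, T, hT, hK⟩ := IsTrajectory.exists_uniform_bound hσ (μ / δ)
  refine ⟨K, T, hT, ?_⟩
  filter_upwards [hp.trajectory] with x hx t ht
  exact hK _ _ _ hx hyt hY t ht

end IsFlow

end QuasistaticVisco

/-! ### Integrability of the mean stress and the lower bound -/

/-- Points whose values are exceeded only on a set of small measure. -/
theorem measure_setOf_measure_lt_le_pos {α : Type*} [MeasurableSpace α] {ν : Measure α}
    [IsProbabilityMeasure ν] {f : α → ℝ} (hf : AEMeasurable f ν) {A K : ℝ}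
    (h0 : ∀ᵐ x ∂ν, A ≤ f x) (hK : ∀ᵐ x ∂ν, f x ≤ K) {η : ENNReal} (hη : 0 < η) :
    ν {y | ν {x | f y < f x} ≤ η} ≠ 0 := by
  have hbdd : IsBoundedUnder (· ≤ ·) (ae ν) f := ⟨K, hK⟩
  have hbdd' : IsBoundedUnder (· ≥ ·) (ae ν) f := ⟨A, h0⟩
  have hcob : IsCoboundedUnder (· ≤ ·) (ae ν) f := hbdd'.isCoboundedUnder_le
  set c := essSup f ν with hc
  have hle : ∀ᵐ x ∂ν, f x ≤ c := ae_le_essSup hbdd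
  have hlt : ∀ b < c, ν {x | b < f x} ≠ 0 := fun b hb => by
    have := frequently_lt_of_lt_limsup hcob hb
    rwa [frequently_ae_iff] at this
  -- If the essential supremum `c` is not attained on a set of positive measure, the sets `{f > c -
  -- 1/(n+1)}` have positive measure shrinking to zero, and every point of a small one qualifies.
  -- Otherwise the points with `f ≥ c` are exceeded only on a null set.
  by_cases hcase : ν {x | c ≤ f x} = 0
  · have hanti : Antitone fun n : ℕ => {x | c - 1 / ((n : ℝ) + 1) < f x} := by
      intro n m hnm x hx
      have : 1 / ((m : ℝ) + 1) ≤ 1 / ((n : ℝ) + 1) := by gcongr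
      simp only [mem_ofPred_eq] at hx ⊢
      linarith
    have hlim := tendsto_measure_iInter_atTop (μ := ν)
      (s := fun n : ℕ => {x | c - 1 / ((n : ℝ) + 1) < f x})
      (fun n => nullMeasurableSet_lt aemeasurable_const hf) hanti ⟨0, measure_ne_top _ _⟩
    have hInter : (⋂ n : ℕ, {x | c - 1 / ((n : ℝ) + 1) < f x}) = {x | c ≤ f x} := by
      ext x
      simp only [mem_iInter, mem_ofPred_eq]
      refine ⟨fun h => ?_, fun h n => ?_⟩
      · by_contra! hcon
        obtain ⟨n, hn⟩ := exists_nat_one_div_lt (sub_pos.2 hcon)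
        linarith [h n]
      · have : 0 < 1 / ((n : ℝ) + 1) := by positivity
        linarith
    rw [hInter, hcase] at hlim
    obtain ⟨n, hn⟩ := (hlim.eventually (gt_mem_nhds hη)).exists
    have hpos : 0 < 1 / ((n : ℝ) + 1) := by positivity
    refine fun h => hlt (c - 1 / ((n : ℝ) + 1)) (by linarith)
      (measure_mono_null (fun y hy => ?_) h)
    refine le_trans (measure_mono fun x hx => ?_) (le_of_lt hn)
    exact lt_trans (show _ < f y from hy) hx
  · refine fun h => hcase (measure_mono_null (fun y hy => ?_) h)
    have : ν {x | f y < f x} = 0 := by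
      refine measure_mono_null (fun x hx => ?_) (ae_iff.1 hle)
      exact not_le.2 (lt_of_le_of_lt hy hx)
    exact this.trans_le zero_le

namespace QuasistaticVisco

variable {σ : ℝ → ℝ} {μ : ℝ} {p : ℝ → ℝ → ℝ}

/-- Mass below the level `c` cannot lose ground: the integral of `η + σ(f) - ∫ σ(f)` over
`{f < c}` is nonpositive. -/
theorem integral_indicator_low_level_le {ν : Measure ℝ} [IsProbabilityMeasure ν] {f : ℝ → ℝ}
    (hf : AEMeasurable f ν) {K a c η : ℝ} (hpos : ∀ᵐ x ∂ν, 0 < f x) (hK : ∀ᵐ x ∂ν, f x ≤ K)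
    (hint : Integrable (fun x => σ (f x)) ν) (hca : c ≤ a)
    (h1 : ∀ z, 0 < z → z ≤ c → σ z ≤ σ c) (h2 : ∀ z, c ≤ z → z ≤ K → σ c ≤ σ z)
    (h3 : ∀ z, a ≤ z → z ≤ K → σ c + 1 ≤ σ z) (hη : η ≤ ν.real {x | a ≤ f x}) :
    ∫ x, {x | f x < c}.indicator (fun x => η + σ (f x) - ∫ y, σ (f y) ∂ν) x ∂ν ≤ 0 := by
  set B := {x | f x < c} with hB
  set Q := {x | a ≤ f x} with hQ
  have hBm : NullMeasurableSet B ν := nullMeasurableSet_lt hf aemeasurable_const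
  have hQm : NullMeasurableSet Q ν := nullMeasurableSet_le aemeasurable_const hf
  set b := ν.real B with hb
  set q := ν.real Q with hq
  set m := ∫ y, σ (f y) ∂ν with hm
  set I := ∫ x in B, σ (f x) ∂ν with hI
  have hb1 : b ≤ 1 := measureReal_le_one
  have hb0 : 0 ≤ b := measureReal_nonneg
  have hIle : I ≤ b * σ c := by
    have : I ≤ ∫ _x in B, σ c ∂ν := by
      refine setIntegral_mono_on_ae₀ hint.integrableOn (integrable_const _).integrableOn hBm ?_
      filter_upwards [hpos] with x hx hxB
      exact h1 _ hx (le_of_lt hxB)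
    simpa [hb] using this
  -- Pointwise `σ(f)` is at least `σ(c)` off `B`, with one more on `Q`; `B` and `Q` are disjoint
  -- because `c ≤ a`.
  have hmge : I + σ c * (1 - b) + q ≤ m := by
    have hle : ∫ x, (B.indicator (fun x => σ (f x) - σ c) x + σ c + Q.indicator (fun _ => 1) x) ∂ν
        ≤ m := by
      refine integral_mono_ae ?_ hint ?_
      · exact (((hint.sub (integrable_const _)).indicator₀ hBm).add (integrable_const _)).add
          ((integrable_const _).indicator₀ hQm)
      · filter_upwards [hK] with x hx
        by_cases hxB : x ∈ B
        · have hxQ : x ∉ Q := fun h => absurd (hca.trans h) (not_le.2 hxB)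
          simp [hxB, hxQ]
        · have hcx : c ≤ f x := not_lt.1 hxB
          by_cases hxQ : x ∈ Q
          · simpa [hxB, hxQ] using h3 _ hxQ hx
          · simpa [hxB, hxQ] using h2 _ hcx hx
    rw [integral_add, integral_add, integral_indicator₀ hBm, integral_indicator₀ hQm,
      integral_sub hint.integrableOn (integrable_const _).integrableOn] at hle
    · simp only [integral_const, smul_eq_mul, probReal_univ, one_mul,
        measureReal_restrict_apply_univ, mul_one] at hle
      linarith
    · exact (hint.sub (integrable_const _)).indicator₀ hBm
    · exact integrable_const _
    · exact ((hint.sub (integrable_const _)).indicator₀ hBm).add (integrable_const _)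
    · exact (integrable_const _).indicator₀ hQm
  -- The integral is `b η + I - b m ≤ b (η - q) + (1 - b) (I - b σ(c))`, and both terms are
  -- nonpositive.
  rw [integral_indicator₀ hBm, integral_sub, integral_add]
  · simp only [integral_const, smul_eq_mul, measureReal_restrict_apply_univ]
    have e1 : b * (I + σ c * (1 - b) + q) ≤ b * m := mul_le_mul_of_nonneg_left hmge hb0
    have e2 : (1 - b) * I ≤ (1 - b) * (b * σ c) := mul_le_mul_of_nonneg_left hIle (by linarith)
    have e3 : b * η ≤ b * q := mul_le_mul_of_nonneg_left hη hb0
    simp only [← hb, ← hI]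
    nlinarith
  · exact (integrable_const _).integrableOn
  · exact hint.integrableOn
  · exact ((integrable_const _).add hint).integrableOn
  · exact (integrable_const _).integrableOn

/-- By continuity rational times suffice; this turns a bound at each time for almost every `x` into
one for almost every `x` at all times. -/
theorem IsTrajectory.le_of_forall_rat {m u : ℝ → ℝ} (hu : IsTrajectory σ m u) {e s : ℝ} (hs : 1 ≤ s)
    (h : ∀ r : ℚ, s ≤ r → e ≤ u r) {t : ℝ} (ht : s ≤ t) : e ≤ u t := by
  by_contra! hneg
  have h1 : ∀ᶠ r in 𝓝[>] t, u r < e :=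
    ((hu.continuousOn t (hs.trans ht)).mono_left (nhdsWithin_mono _ fun r hr =>
      (hs.trans ht).trans (le_of_lt hr))) |>.eventually (gt_mem_nhds hneg)
  obtain ⟨w, hw, hw'⟩ := mem_nhdsGT_iff_exists_Ioo_subset.1 h1
  obtain ⟨r, hr1, hr2⟩ := exists_rat_btwn (mem_Ioi.1 hw)
  exact absurd (h r (ht.trans hr1.le)) (not_le.2 (hw' ⟨hr1, hr2⟩))

namespace IsFlow

theorem aemeasurable_slice (hp : IsFlow σ μ p) {t : ℝ} (ht : 1 ≤ t) :
    AEMeasurable (fun x => p x t) unitMeasure := (hp.memLp t ht).aestronglyMeasurable.aemeasurable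

/-- If `q` is the measure on the right, then `μ ≤ μ/2 + (K - μ/2) q`. -/
theorem level_measure_ge (hp : IsFlow σ μ p) {K t : ℝ} (hK0 : 0 < K) (ht : 1 ≤ t)
    (hK : ∀ᵐ x ∂unitMeasure, p x t ≤ K) :
    μ / (2 * K) ≤ unitMeasure.real {x | μ / 2 ≤ p x t} := by
  have hQm : NullMeasurableSet {x | μ / 2 ≤ p x t} unitMeasure :=
    nullMeasurableSet_le aemeasurable_const (hp.aemeasurable_slice ht)
  have hle : ∫ x, p x t ∂unitMeasure ≤
      ∫ x, (μ / 2 + {x | μ / 2 ≤ p x t}.indicator (fun _ => K - μ / 2) x) ∂unitMeasure := by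
    refine integral_mono_ae (hp.integrable ht)
      ((integrable_const _).add ((integrable_const _).indicator₀ hQm)) ?_
    filter_upwards [hK] with x hx
    by_cases hxQ : μ / 2 ≤ p x t
    · simp only [indicator_of_mem (show x ∈ {x | μ / 2 ≤ p x t} from hxQ)]; linarith
    · simp only [indicator_of_notMem (show x ∉ {x | μ / 2 ≤ p x t} from hxQ)]
      linarith [not_le.1 hxQ]
  rw [hp.mass t ht, integral_add (integrable_const _) ((integrable_const _).indicator₀ hQm),
    integral_indicator₀ hQm] at hle
  simp only [integral_const, smul_eq_mul, probReal_univ, one_mul,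
    measureReal_restrict_apply_univ] at hle
  have hm : 0 ≤ μ := by
    rw [← hp.mass t ht]
    exact integral_nonneg_of_ae (hp.nonneg ht)
  have hq : 0 ≤ unitMeasure.real {x | μ / 2 ≤ p x t} := measureReal_nonneg
  rw [div_le_iff₀ (by positivity)]
  nlinarith

/-- Once the solution is bounded above, the mean stress is locally integrable in time. -/
theorem intervalIntegrable_meanStress (hσ : StressAssumptions σ) (hC : ContDiffOn ℝ 1 σ (Ioi 0))
    (hμ : 0 < μ) (hp : IsFlow σ μ p) {K T : ℝ} (hT : 1 ≤ T)
    (hK : ∀ᵐ x ∂unitMeasure, ∀ t, T ≤ t → p x t ≤ K) {t : ℝ} (ht : T ≤ t) :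
    IntervalIntegrable (meanStress σ p) volume T t := by
  have hK0 : 0 < K := by
    have : μ ≤ K := by
      rw [← hp.mass T hT]
      refine (integral_mono_ae (hp.integrable hT) (integrable_const K) ?_).trans (by simp)
      filter_upwards [hK] with x hx using hx T le_rfl
    linarith
  -- Only `σ(p) - m` is known to be integrable in time, so a trajectory along which `σ(p)` is
  -- continuous is needed. If `y` is exceeded at time `T` on measure at most `μ/(4K)`, ordering
  -- gives `μ ≤ p y s + K μ/(4K)`, so `p y` stays away from `0`.
  have hq := measure_setOf_measure_lt_le_pos (hp.aemeasurable_slice hT) (hp.nonneg hT)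
    (by filter_upwards [hK] with x hx using hx T le_rfl)
    (η := ENNReal.ofReal (μ / (4 * K))) (by simpa using by positivity)
  obtain ⟨y, hy, hyt⟩ : ∃ y, IsTrajectory σ (meanStress σ p) (p y) ∧
      unitMeasure {x | p y T < p x T} ≤ ENNReal.ofReal (μ / (4 * K)) := by
    by_contra! hcon
    refine hq (measure_mono_null (fun x hx => ?_) (ae_iff.1 hp.trajectory))
    exact fun hx' => absurd hx (not_le.2 (hcon x hx'))
  have hyt' : unitMeasure.real {x | p y T < p x T} ≤ μ / (4 * K) :=
    ENNReal.toReal_le_of_le_ofReal (by positivity) hyt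
  have hlow : ∀ s, T ≤ s → μ / 2 ≤ p y s := by
    intro s hs
    have hsm : NullMeasurableSet {x | p y T < p x T} unitMeasure :=
      nullMeasurableSet_lt aemeasurable_const (hp.aemeasurable_slice hT)
    have hle : ∫ x, p x s ∂unitMeasure ≤
        ∫ x, (p y s + {x | p y T < p x T}.indicator (fun _ => K) x) ∂unitMeasure := by
      refine integral_mono_ae (hp.integrable (hT.trans hs))
        ((integrable_const _).add ((integrable_const _).indicator₀ hsm)) ?_
      filter_upwards [hK, hp.trajectory] with x hx hxt
      by_cases h : p y T < p x T
      · simp only [indicator_of_mem (show x ∈ {x | p y T < p x T} from h)]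
        linarith [hx s hs, hy.nonneg (hT.trans hs)]
      · simp only [indicator_of_notMem (show x ∉ {x | p y T < p x T} from h)]
        linarith [hxt.le_of_le hσ hC hy hT hs (not_lt.1 h)]
    rw [hp.mass s (hT.trans hs), integral_add (integrable_const _)
      ((integrable_const _).indicator₀ hsm), integral_indicator₀ hsm] at hle
    simp only [integral_const, smul_eq_mul, probReal_univ, one_mul,
      measureReal_restrict_apply_univ] at hle
    have : unitMeasure.real {x | p y T < p x T} * K ≤ μ / (4 * K) * K := by gcongr
    have e : μ / (4 * K) * K = μ / 4 := by field_simp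
    linarith
  have hcont : ContinuousOn (fun s => σ (p y s)) (uIcc T t) := by
    rw [uIcc_of_le ht]
    refine hσ.continuousOn.comp (hy.continuousOn.mono fun s hs => hT.trans hs.1) fun s hs => ?_
    exact (half_pos hμ).trans_le (hlow s hs.1)
  exact (hcont.intervalIntegrable.sub (hy.integrable T t hT ht)).congr fun s _ => by simp

end IsFlow

end QuasistaticVisco

namespace QuasistaticVisco

variable {σ : ℝ → ℝ} {μ : ℝ} {p : ℝ → ℝ → ℝ}

/-- Nothing is known about `σ` outside `(0,∞)`, so it is replaced by zero there. -/
theorem StressAssumptions.aemeasurable_comp (hσ : StressAssumptions σ) {α : Type*}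
    [MeasurableSpace α] {ν : Measure α} {f : α → ℝ} (hf : AEMeasurable f ν)
    (hpos : ∀ᵐ x ∂ν, 0 < f x) : AEMeasurable (fun x => σ (f x)) ν := by
  classical
  have hm : Measurable ((Ioi (0 : ℝ)).piecewise σ fun _ => 0) :=
    hσ.continuousOn.measurable_piecewise continuousOn_const measurableSet_Ioi
  refine (hm.comp_aemeasurable hf).congr ?_
  filter_upwards [hpos] with x hx
  simp [hx]

namespace IsFlow

/-- The one-sided bound `σ(p) ≤ S` gives `|σ(p)| ≤ 2|S| - σ(p)`, whose integral over `x` is `2|S| -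
m(s)`, integrable in `s`. This permits Fubini before `p` is known to be bounded below. -/
theorem integrable_stress_prod (hσ : StressAssumptions σ) (hC : ContDiffOn ℝ 1 σ (Ioi 0))
    (hμ : 0 < μ) (hp : IsFlow σ μ p) {K T : ℝ} (hT : 1 ≤ T)
    (hK : ∀ᵐ x ∂unitMeasure, ∀ t, T ≤ t → p x t ≤ K) {t : ℝ} (ht : T ≤ t) :
    Integrable (fun z : ℝ × ℝ => σ (p z.1 z.2))
      (unitMeasure.prod (volume.restrict (Icc T t))) := by
  obtain ⟨S, hS⟩ := hσ.exists_upper_bound K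
  have hmeas : AEStronglyMeasurable (fun z : ℝ × ℝ => σ (p z.1 z.2))
      (unitMeasure.prod (volume.restrict (Icc T t))) :=
    (hσ.aemeasurable_comp (hp.aemeasurable T t hT) (hp.pos T t hT)).aestronglyMeasurable
  have hsl : ∀ᵐ s ∂(volume.restrict (Icc T t)), Integrable (fun x => σ (p x s)) unitMeasure := by
    rw [ae_restrict_iff' measurableSet_Icc]
    filter_upwards [hp.integrable_stress] with s hs hmem using hs (hT.trans hmem.1)
  have hposx : ∀ᵐ s ∂(volume.restrict (Icc T t)), ∀ᵐ x ∂unitMeasure, 0 < p x s :=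
    Measure.ae_ae_of_ae_prod (Measure.measurePreserving_swap.quasiMeasurePreserving.ae (hp.pos T t hT))
  refine (integrable_prod_iff' hmeas).2 ⟨hsl, ?_⟩
  have hm : IntegrableOn (meanStress σ p) (Icc T t) := by
    rw [integrableOn_Icc_iff_integrableOn_Ioc, ← intervalIntegrable_iff_integrableOn_Ioc_of_le ht]
    exact hp.intervalIntegrable_meanStress hσ hC hμ hT hK ht
  have hbd : Integrable (fun s => 2 * |S| - meanStress σ p s) (volume.restrict (Icc T t)) :=
    (integrable_const _).sub hm
  refine hbd.mono' hmeas.norm.prod_swap.integral_prod_right' ?_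
  filter_upwards [hsl, hposx, ae_restrict_mem measurableSet_Icc] with s h1 h2 h3
  rw [Real.norm_of_nonneg (integral_nonneg fun _ => norm_nonneg _)]
  have : ∫ x, ‖σ (p x s)‖ ∂unitMeasure ≤ ∫ x, (2 * |S| - σ (p x s)) ∂unitMeasure := by
    refine integral_mono_ae h1.norm ((integrable_const _).sub h1) ?_
    filter_upwards [hK, h2] with x hx hpos
    have := hS _ hpos (hx s h3.1)
    rw [Real.norm_eq_abs]
    have h4 := le_abs_self S
    have h5 := abs_nonneg S
    exact abs_le'.2 ⟨by linarith, by linarith⟩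
  rw [integral_sub (integrable_const _) h1] at this
  simpa [meanStress] using this

/-- Once bounded above, the solution becomes uniformly positive. -/
theorem exists_lower_bound (hσ : StressAssumptions σ) (hC : ContDiffOn ℝ 1 σ (Ioi 0))
    (hμ : 0 < μ) (hp : IsFlow σ μ p) {K T : ℝ} (hT : 1 ≤ T)
    (hK : ∀ᵐ x ∂unitMeasure, ∀ t, T ≤ t → p x t ≤ K) :
    ∃ e > 0, ∃ T' ≥ T, ∀ᵐ x ∂unitMeasure, ∀ t, T' ≤ t → e ≤ p x t := by
  have hK0 : 0 < K := by
    have : μ ≤ K := by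
      rw [← hp.mass T hT]
      refine (integral_mono_ae (hp.integrable hT) (integrable_const K) ?_).trans (by simp)
      filter_upwards [hK] with x hx using hx T le_rfl
    linarith
  obtain ⟨e, he, hea, hlev⟩ := hσ.exists_low_level (half_pos hμ) K
  set η := μ / (2 * K) with hη
  have hη0 : 0 < η := by positivity
  have hfix : ∀ t, T + e / η ≤ t → ∀ᵐ x ∂unitMeasure, e ≤ p x t := by
    intro t ht
    set s := t - e / η with hs
    have hTs : T ≤ s := by linarith
    have h1s : 1 ≤ s := hT.trans hTs
    have hst : s ≤ t := by linarith [div_pos he hη0]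
    have hKs : ∀ᵐ x ∂unitMeasure, ∀ r, s ≤ r → p x r ≤ K := by
      filter_upwards [hK] with x hx r hr using hx r (hTs.trans hr)
    -- A level rising from `0` at time `s` to `e` at time `t`. The mass deficit `∫ (c - p)⁺` starts
    -- at zero and has derivative `∫_{p<c} (η + σ(p) - m) ≤ 0`, so it vanishes at time `t`.
    set c : ℝ → ℝ := fun r => η * (r - s) with hc
    have hct : c t = e := by simp only [hc, hs]; field_simp; ring
    set g : ℝ × ℝ → ℝ := {z : ℝ × ℝ | p z.1 z.2 < c z.2}.indicator
      (fun z => η + σ (p z.1 z.2) - meanStress σ p z.2) with hg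
    have hmint : Integrable (meanStress σ p) (volume.restrict (Icc s t)) := by
      have : IntegrableOn (meanStress σ p) (Icc s t) := by
        rw [integrableOn_Icc_iff_integrableOn_Ioc,
          ← intervalIntegrable_iff_integrableOn_Ioc_of_le hst]
        exact hp.intervalIntegrable_meanStress hσ hC hμ h1s hKs hst
      exact this
    have hgint : Integrable g (unitMeasure.prod (volume.restrict (Icc s t))) := by
      refine Integrable.indicator₀ ?_ (nullMeasurableSet_lt (hp.aemeasurable s t h1s) ?_)
      · exact ((integrable_const _).add
          (hp.integrable_stress_prod hσ hC hμ h1s hKs hst)).sub (hmint.comp_snd _)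
      · exact ((measurable_id.sub_const s).const_mul η |>.comp measurable_snd).aemeasurable
    have hpoint : ∀ᵐ x ∂unitMeasure,
        max (e - p x t) 0 = ∫ r in Icc s t, g (x, r) := by
      filter_upwards [hp.trajectory] with x hx
      have hac := hx.ac h1s hst
      have hcac : AbsolutelyContinuousOnInterval c s t :=
        ContDiffOn.absolutelyContinuousOnInterval
          (contDiff_const.mul (contDiff_id.sub contDiff_const)).contDiffOn
      have := max_zero_eq_add_integral (f := fun r => c r - p x r)
        (g := fun r => η - (meanStress σ p r - σ (p x r))) hst (hcac.sub hac.1) ?_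
      · simp only [hct] at this
        have h0 : max (c s - p x s) 0 = 0 := max_eq_right (by simp [hc, hx.nonneg h1s])
        rw [this, h0, zero_add, intervalIntegral.integral_of_le hst, integral_Icc_eq_integral_Ioc]
        refine integral_congr_ae (Eventually.of_forall fun r => ?_)
        by_cases hr : p x r < c r
        · simp [hg, indicator, hr]; ring
        · simp [hg, indicator, hr]
      · filter_upwards [hac.2] with r hr hmem
        refine HasDerivAt.fun_sub ?_ (hr hmem)
        simpa using ((hasDerivAt_id r).sub_const s).const_mul η
    have hint : ∫ x, max (e - p x t) 0 ∂unitMeasure ≤ 0 := by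
      rw [integral_congr_ae hpoint, integral_integral_swap (f := fun x r => g (x, r)) hgint]
      refine integral_nonpos_of_ae ?_
      have hposx : ∀ᵐ r ∂(volume.restrict (Icc s t)), ∀ᵐ x ∂unitMeasure, 0 < p x r :=
        Measure.ae_ae_of_ae_prod
          (Measure.measurePreserving_swap.quasiMeasurePreserving.ae (hp.pos s t h1s))
      have hne : ∀ᵐ r ∂(volume.restrict (Icc s t)), r ≠ s :=
        ae_restrict_of_ae (by simp [ae_iff, measure_singleton])
      filter_upwards [hposx, ae_restrict_mem measurableSet_Icc, hne,
        ae_restrict_of_ae hp.integrable_stress] with r h1 h2 h3 h4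
      have hr1 : 1 ≤ r := h1s.trans h2.1
      have hKr : ∀ᵐ x ∂unitMeasure, p x r ≤ K := by
        filter_upwards [hKs] with x hx using hx r h2.1
      have hcr : 0 < c r := mul_pos hη0 (sub_pos.2 (lt_of_le_of_ne h2.1 h3.symm))
      have hce : c r ≤ e := by
        rw [← hct]
        exact mul_le_mul_of_nonneg_left (by linarith [h2.2]) hη0.le
      obtain ⟨l1, l2, l3⟩ := hlev (c r) hcr hce
      exact integral_indicator_low_level_le (hp.aemeasurable_slice hr1) h1 hKr (h4 hr1)
        (hce.trans hea) l1 l2 l3 (hp.level_measure_ge hK0 hr1 hKr)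
    have ht1 : 1 ≤ t := h1s.trans hst
    have hi : Integrable (fun x => max (e - p x t) 0) unitMeasure :=
      ((integrable_const e).sub (hp.integrable ht1)).pos_part
    have hz := (integral_eq_zero_iff_of_nonneg (fun x => le_max_right _ _) hi).1
      (le_antisymm hint (integral_nonneg fun x => le_max_right _ _))
    filter_upwards [hz] with x hx
    have := max_eq_right_iff.1 hx
    simp only [Pi.zero_apply] at this
    linarith
  refine ⟨e, he, T + e / η, by linarith [div_pos he hη0], ?_⟩
  have hrat : ∀ᵐ x ∂unitMeasure, ∀ r : ℚ, T + e / η ≤ r → e ≤ p x r := by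
    rw [ae_all_iff]
    intro r
    by_cases hr : T + e / η ≤ r
    · filter_upwards [hfix r hr] with x hx _ using hx
    · exact Eventually.of_forall fun x h => absurd h hr
  filter_upwards [hrat, hp.trajectory] with x hx hxt t ht
  exact hxt.le_of_forall_rat (by linarith [div_pos he hη0]) hx ht

end IsFlow

end QuasistaticVisco

/-! ### Regularity in time and decay of the dissipation -/

/-- A Lipschitz function with square integrable tail tends to zero. -/
theorem LipschitzWith.tendsto_zero_of_integral_sq_le {f : ℝ → ℝ} {Λ : NNReal}
    (hf : LipschitzWith Λ f) {T B : ℝ} (hB : ∀ t, T ≤ t → ∫ r in T..t, f r ^ 2 ≤ B) :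
    Tendsto f atTop (𝓝 0) := by
  have hc : Continuous fun r => f r ^ 2 := hf.continuous.pow 2
  have hi : ∀ a b, IntervalIntegrable (fun r => f r ^ 2) volume a b := fun a b =>
    hc.intervalIntegrable a b
  set G : ℝ → ℝ := fun t => ∫ r in T..t, f r ^ 2 with hG
  have hsub : ∀ a b, G b - G a = ∫ r in a..b, f r ^ 2 := fun a b =>
    intervalIntegral.integral_interval_sub_left (hi _ _) (hi _ _)
  have hmono : Monotone G := fun a b hab => by
    rw [← sub_nonneg, hsub]
    exact intervalIntegral.integral_nonneg hab fun r _ => sq_nonneg _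
  have hbdd : BddAbove (range G) := by
    refine ⟨B, ?_⟩
    rintro _ ⟨t, rfl⟩
    exact (hmono (le_max_left t T)).trans (hB _ (le_max_right _ _))
  have hlim := tendsto_atTop_ciSup hmono hbdd
  rw [Metric.tendsto_atTop]
  intro ε hε
  -- If `|f t| ≥ ε`, then `|f| ≥ ε/2` on `[t, t + δ]`, so `G` grows there by at least `δ (ε/2)²`.
  set δ : ℝ := ε / (2 * (Λ + 1)) with hδ
  have hδ0 : 0 < δ := by positivity
  have hdiff : Tendsto (fun t => G (t + δ) - G t) atTop (𝓝 0) := by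
    simpa using (hlim.comp (tendsto_atTop_add_const_right _ δ tendsto_id)).sub hlim
  have hev := hdiff.eventually (gt_mem_nhds (show 0 < δ * (ε / 2) ^ 2 by positivity))
  obtain ⟨N, hN⟩ := eventually_atTop.1 hev
  refine ⟨N, fun t ht => ?_⟩
  rw [Real.dist_eq, sub_zero]
  by_contra! hcon
  have h1 := hN t ht
  rw [hsub] at h1
  have h2 : ∫ _r in t..(t + δ), (ε / 2) ^ 2 ≤ ∫ r in t..(t + δ), f r ^ 2 := by
    refine intervalIntegral.integral_mono_on (by linarith) intervalIntegrable_const (hi _ _)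
      fun r hr => ?_
    have hl := hf.dist_le_mul r t
    rw [Real.dist_eq, Real.dist_eq, abs_of_nonneg (sub_nonneg.2 hr.1)] at hl
    have h3 : (Λ : ℝ) * (r - t) ≤ ε / 2 := by
      have : (Λ : ℝ) * (r - t) ≤ (Λ + 1) * δ := by
        have := Λ.2
        exact mul_le_mul (by linarith) (by linarith [hr.2]) (by linarith [hr.1]) (by linarith)
      have e : ((Λ : ℝ) + 1) * δ = ε / 2 := by rw [hδ]; field_simp
      linarith
    have h4 : ε / 2 ≤ |f r| := by
      have := abs_sub_abs_le_abs_sub (f t) (f r)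
      rw [abs_sub_comm] at this
      linarith
    rw [← sq_abs (f r)]
    gcongr
  rw [intervalIntegral.integral_const, smul_eq_mul] at h2
  simp only [add_sub_cancel_left] at h2
  linarith

namespace QuasistaticVisco

variable {σ : ℝ → ℝ} {μ : ℝ} {p : ℝ → ℝ → ℝ}

/-- A solution that from time `T` on takes values in a compact subinterval of `(0,∞)`, together
with the regularity in time that follows from it. -/
structure IsRegularFlow (σ : ℝ → ℝ) (μ : ℝ) (p : ℝ → ℝ → ℝ) (T ε K Λ : ℝ) : Prop where
  flow : IsFlow σ μ p
  one_le : 1 ≤ T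
  eps_pos : 0 < ε
  lip_nonneg : 0 ≤ Λ
  bounds : ∀ᵐ x ∂unitMeasure, ∀ t, T ≤ t → p x t ∈ Icc ε K
  lip_stress : ∀ᵐ x ∂unitMeasure, ∀ s t, T ≤ s → T ≤ t →
    |σ (p x t) - σ (p x s)| ≤ Λ * |t - s|
  lip_mean : ∀ s t, T ≤ s → T ≤ t → |meanStress σ p t - meanStress σ p s| ≤ Λ * |t - s|
  continuousOn : ∀ᵐ x ∂unitMeasure, ContinuousOn (p x) (Ici T)
  deriv : ∀ᵐ x ∂unitMeasure, ∀ t, T < t → HasDerivAt (p x) (meanStress σ p t - σ (p x t)) t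

theorem continuousOn_of_abs_le {f : ℝ → ℝ} {T Λ : ℝ}
    (h : ∀ s t, T ≤ s → T ≤ t → |f t - f s| ≤ Λ * |t - s|) : ContinuousOn f (Ici T) := by
  refine (LipschitzOnWith.of_dist_le_mul (K := Λ.toNNReal) fun t ht s hs => ?_).continuousOn
  rw [Real.dist_eq, Real.dist_eq]
  exact (h s t hs ht).trans (mul_le_mul_of_nonneg_right (Real.le_coe_toNNReal _) (abs_nonneg _))

theorem IsFlow.integrable_stress_slice (hσ : StressAssumptions σ) (hp : IsFlow σ μ p) {T ε K : ℝ}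
    (hT : 1 ≤ T) (hε : 0 < ε) (hb : ∀ᵐ x ∂unitMeasure, ∀ t, T ≤ t → p x t ∈ Icc ε K) {t : ℝ}
    (ht : T ≤ t) : Integrable (fun x => σ (p x t)) unitMeasure := by
  obtain ⟨S, hS⟩ := isCompact_Icc.exists_bound_of_continuousOn
    (hσ.continuousOn.mono fun z (hz : z ∈ Icc ε K) => hε.trans_le hz.1)
  refine Integrable.of_bound (hσ.aemeasurable_comp (hp.aemeasurable_slice (hT.trans ht))
    ?_).aestronglyMeasurable S ?_
  · filter_upwards [hb] with x hx using hε.trans_le (hx t ht).1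
  · filter_upwards [hb] with x hx using hS _ (hx t ht)

/-- On `[ε, K]` one has `|σ| ≤ S` and a Lipschitz constant `L`. Hence `|p_t| ≤ 2S`, the stress and
its mean are `2SL`-Lipschitz in time, and the integral identity becomes a classical derivative. -/
theorem IsFlow.exists_isRegularFlow (hσ : StressAssumptions σ) (hC : ContDiffOn ℝ 1 σ (Ioi 0))
    (hμ : 0 < μ) (hp : IsFlow σ μ p) : ∃ T ε K Λ, IsRegularFlow σ μ p T ε K Λ := by
  obtain ⟨K, T₀, hT₀, hK⟩ := hp.exists_upper_bound hσ hC
  obtain ⟨ε, hε, T, hT, hlow⟩ := hp.exists_lower_bound hσ hC hμ hT₀ hK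
  have h1T : 1 ≤ T := hT₀.trans hT
  have hb : ∀ᵐ x ∂unitMeasure, ∀ t, T ≤ t → p x t ∈ Icc ε K := by
    filter_upwards [hK, hlow] with x h1 h2 t ht using ⟨h2 t ht, h1 t (le_trans hT ht)⟩
  obtain ⟨S, hS⟩ := isCompact_Icc.exists_bound_of_continuousOn
    (hσ.continuousOn.mono fun z (hz : z ∈ Icc ε K) => hε.trans_le hz.1)
  obtain ⟨L, hL⟩ := exists_lipschitzOnWith_Icc hC hε K
  have hm : ∀ t, T ≤ t → |meanStress σ p t| ≤ S := by
    intro t ht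
    have h := norm_integral_le_of_norm_le_const (μ := unitMeasure) (f := fun x => σ (p x t))
      (C := S) (by filter_upwards [hb] with x hx using hS _ (hx t ht))
    rwa [probReal_univ, mul_one] at h
  have hS0 : 0 ≤ S := (abs_nonneg _).trans (hm T le_rfl)
  have hlipx : ∀ᵐ x ∂unitMeasure, ∀ s t, T ≤ s → T ≤ t →
      |σ (p x t) - σ (p x s)| ≤ L * (2 * S) * |t - s| := by
    filter_upwards [hb, hp.trajectory] with x hx hxt
    have key : ∀ s t, T ≤ s → s ≤ t → |p x t - p x s| ≤ 2 * S * |t - s| := by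
      intro s t hs hst
      rw [hxt.integral_eq s t (h1T.trans hs) hst, sub_sub_cancel_left, abs_neg]
      rw [← Real.norm_eq_abs]
      refine intervalIntegral.norm_integral_le_of_norm_le_const fun r hr => ?_
      rw [uIoc_of_le hst] at hr
      have hr' : T ≤ r := hs.trans hr.1.le
      have h1 : |σ (p x r)| ≤ S := hS _ (hx r hr')
      exact (abs_sub _ _).trans (by linarith [hm r hr'])
    have key' : ∀ s t, T ≤ s → T ≤ t → |p x t - p x s| ≤ 2 * S * |t - s| := by
      intro s t hs ht
      rcases le_total s t with h | h
      · exact key s t hs h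
      · rw [abs_sub_comm, abs_sub_comm t s]; exact key t s ht h
    intro s t hs ht
    have h1 := hL.dist_le_mul _ (hx t ht) _ (hx s hs)
    rw [Real.dist_eq, Real.dist_eq] at h1
    calc _ ≤ L * |p x t - p x s| := h1
      _ ≤ L * (2 * S * |t - s|) := mul_le_mul_of_nonneg_left (key' s t hs ht) L.2
      _ = _ := by ring
  have hlipm : ∀ s t, T ≤ s → T ≤ t →
      |meanStress σ p t - meanStress σ p s| ≤ L * (2 * S) * |t - s| := by
    intro s t hs ht
    rw [meanStress, meanStress, ← integral_sub (hp.integrable_stress_slice hσ h1T hε hb ht)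
      (hp.integrable_stress_slice hσ h1T hε hb hs)]
    have h := norm_integral_le_of_norm_le_const (μ := unitMeasure)
      (f := fun x => σ (p x t) - σ (p x s)) (C := L * (2 * S) * |t - s|)
      (by filter_upwards [hlipx] with x hx using hx s t hs ht)
    rwa [probReal_univ, mul_one] at h
  refine ⟨T, ε, K, L * (2 * S), hp, h1T, hε, mul_nonneg L.2 (by linarith), hb, hlipx, hlipm, ?_, ?_⟩
  · filter_upwards [hp.trajectory] with x hx using hx.continuousOn.mono (Ici_subset_Ici.2 h1T)
  · filter_upwards [hp.trajectory, hlipx] with x hx hlx t ht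
    have hcont : ContinuousOn (fun r => σ (p x r) - meanStress σ p r) (Ici T) :=
      (continuousOn_of_abs_le hlx).sub (continuousOn_of_abs_le hlipm)
    have hd : HasDerivAt (fun t => p x T - ∫ r in T..t, (σ (p x r) - meanStress σ p r))
        (-(σ (p x t) - meanStress σ p t)) t := by
      refine HasDerivAt.const_sub _ ?_
      refine intervalIntegral.integral_hasDerivAt_right (hx.integrable T t h1T ht.le) ?_
        (hcont.continuousAt (Ici_mem_nhds ht))
      exact (hcont.mono Ioi_subset_Ici_self).stronglyMeasurableAtFilter isOpen_Ioi _ ht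
    rw [neg_sub] at hd
    refine hd.congr_of_eventuallyEq ?_
    filter_upwards [Ioi_mem_nhds ht] with r hr
    exact hx.integral_eq T r h1T (le_of_lt hr)

namespace IsRegularFlow

variable {T ε K Λ : ℝ}

theorem continuousOn_meanStress (hp : IsRegularFlow σ μ p T ε K Λ) :
    ContinuousOn (meanStress σ p) (Ici T) := continuousOn_of_abs_le hp.lip_mean

theorem exists_stress_bound (hσ : StressAssumptions σ) (hp : IsRegularFlow σ μ p T ε K Λ) :
    ∃ S, (∀ z ∈ Icc ε K, |σ z| ≤ S) ∧ ∀ t, T ≤ t → |meanStress σ p t| ≤ S := by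
  obtain ⟨S, hS⟩ := isCompact_Icc.exists_bound_of_continuousOn
    (hσ.continuousOn.mono fun z (hz : z ∈ Icc ε K) => hp.eps_pos.trans_le hz.1)
  refine ⟨S, hS, fun t ht => ?_⟩
  have h := norm_integral_le_of_norm_le_const (μ := unitMeasure) (f := fun x => σ (p x t))
    (C := S) (by filter_upwards [hp.bounds] with x hx using hS _ (hx t ht))
  rwa [probReal_univ, mul_one] at h

/-- The energy identity bounds the total dissipation. -/
theorem exists_dissipation_bound (hσ : StressAssumptions σ) (hC : ContDiffOn ℝ 1 σ (Ioi 0))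
    (hμ : 0 < μ) (hp : IsRegularFlow σ μ p T ε K Λ) :
    ∃ C : ℝ, ∀ t, T ≤ t →
      Integrable (fun x => ∫ r in Icc T t, (σ (p x r) - meanStress σ p r) ^ 2) unitMeasure ∧
      ∫ x, (∫ r in Icc T t, (σ (p x r) - meanStress σ p r) ^ 2) ∂unitMeasure ≤ C := by
  obtain ⟨S, hS, hm⟩ := hp.exists_stress_bound hσ
  have hWd : ∀ z, 0 < z → HasDerivAt (storedEnergy σ) (σ z) z := fun z hz =>
    hasDerivAt_storedEnergy hσ.continuousOn hz
  obtain ⟨C, hC'⟩ := isCompact_Icc.exists_bound_of_continuousOn (f := storedEnergy σ)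
    (s := Icc ε K) fun z hz =>
      (hWd z (hp.eps_pos.trans_le hz.1)).continuousAt.continuousWithinAt
  refine ⟨2 * C, fun t ht => ?_⟩
  have hKub : ∀ᵐ x ∂unitMeasure, ∀ t, T ≤ t → p x t ≤ K := by
    filter_upwards [hp.bounds] with x hx r hr using (hx r hr).2
  have hs := hp.flow.integrable_stress_prod hσ hC hμ hp.one_le hKub ht
  have hmi : Integrable (meanStress σ p) (volume.restrict (Icc T t)) :=
    (hp.continuousOn_meanStress.mono Icc_subset_Ici_self).integrableOn_Icc
  have hmi' : Integrable (fun z : ℝ × ℝ => meanStress σ p z.2)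
    (unitMeasure.prod (volume.restrict (Icc T t))) := hmi.comp_snd _
  have hq := hs.sub hmi'
  have hgood : ∀ᵐ z ∂(unitMeasure.prod (volume.restrict (Icc T t))),
      |σ (p z.1 z.2)| ≤ S ∧ |meanStress σ p z.2| ≤ S := by
    have h1 := Measure.quasiMeasurePreserving_fst (μ := unitMeasure)
      (ν := volume.restrict (Icc T t)) |>.ae hp.bounds
    have h2 := Measure.quasiMeasurePreserving_snd (μ := unitMeasure)
      (ν := volume.restrict (Icc T t)) |>.ae (ae_restrict_mem measurableSet_Icc)
    filter_upwards [h1, h2] with z hz1 hz2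
    exact ⟨hS _ (hz1 _ hz2.1), hm _ hz2.1⟩
  have hsq : Integrable (fun z : ℝ × ℝ => σ (p z.1 z.2) * (σ (p z.1 z.2) - meanStress σ p z.2))
      (unitMeasure.prod (volume.restrict (Icc T t))) :=
    hq.bdd_mul (c := S) hs.aestronglyMeasurable (hgood.mono fun z hz => hz.1)
  have hmq : Integrable (fun z : ℝ × ℝ => meanStress σ p z.2 *
      (σ (p z.1 z.2) - meanStress σ p z.2))
      (unitMeasure.prod (volume.restrict (Icc T t))) :=
    hq.bdd_mul (c := S) hmi'.aestronglyMeasurable (hgood.mono fun z hz => hz.2)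
  have hqq : Integrable (fun z : ℝ × ℝ => (σ (p z.1 z.2) - meanStress σ p z.2) ^ 2)
      (unitMeasure.prod (volume.restrict (Icc T t))) := by
    refine (hsq.sub hmq).congr (Eventually.of_forall fun z => ?_)
    simp only [Pi.sub_apply]; ring
  refine ⟨hqq.integral_prod_left, ?_⟩
  -- `(σ - m)² = σ(σ - m) - m(σ - m)`: the last term has zero mean in `x`, and `σ(σ - m) = -d/dt
  -- W(p)`, whose time integral is at most `2C` when `|W| ≤ C` on `[ε, K]`.
  have e1 : ∫ x, (∫ r in Icc T t, (σ (p x r) - meanStress σ p r) ^ 2) ∂unitMeasure =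
      ∫ x, (∫ r in Icc T t, σ (p x r) * (σ (p x r) - meanStress σ p r)) ∂unitMeasure -
      ∫ x, (∫ r in Icc T t, meanStress σ p r * (σ (p x r) - meanStress σ p r)) ∂unitMeasure := by
    rw [← integral_prod _ hqq, ← integral_prod _ hsq, ← integral_prod _ hmq,
      ← integral_sub hsq hmq]
    refine integral_congr_ae (Eventually.of_forall fun z => ?_)
    simp only; ring
  have e2 : ∫ x, (∫ r in Icc T t, meanStress σ p r * (σ (p x r) - meanStress σ p r)) ∂unitMeasure
      = 0 := by
    rw [integral_integral_swap hmq]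
    refine setIntegral_eq_zero_of_forall_eq_zero fun r hr => ?_
    rw [integral_const_mul, integral_sub (hp.flow.integrable_stress_slice hσ hp.one_le hp.eps_pos
      hp.bounds hr.1) (integrable_const _)]
    simp [meanStress]
  have e3 : ∫ x, (∫ r in Icc T t, σ (p x r) * (σ (p x r) - meanStress σ p r)) ∂unitMeasure
      ≤ ∫ _x, 2 * C ∂unitMeasure := by
    refine integral_mono_ae hsq.integral_prod_left (integrable_const _) ?_
    filter_upwards [hp.bounds, hp.lip_stress, hp.continuousOn, hp.deriv] with x hx hl hc hd
    have hpc : ContinuousOn (fun r => σ (p x r)) (Ici T) := continuousOn_of_abs_le hl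
    have hcW : ContinuousOn (fun r => storedEnergy σ (p x r)) (Icc T t) := by
      intro r hr
      exact (hWd _ (hp.eps_pos.trans_le (hx r hr.1).1)).continuousAt.comp_continuousWithinAt
        ((hc r hr.1).mono Icc_subset_Ici_self)
    have hfun : ContinuousOn (fun r => σ (p x r) * (meanStress σ p r - σ (p x r))) (Icc T t) :=
      (hpc.mul (hp.continuousOn_meanStress.sub hpc)).mono Icc_subset_Ici_self
    have hFTC := intervalIntegral.integral_eq_sub_of_hasDerivAt_of_le ht hcW
      (f' := fun r => σ (p x r) * (meanStress σ p r - σ (p x r)))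
      (fun r hr => (hWd _ (hp.eps_pos.trans_le (hx r hr.1.le).1)).comp r (hd r hr.1))
      (by rw [intervalIntegrable_iff_integrableOn_Icc_of_le ht]; exact hfun.integrableOn_Icc)
    rw [intervalIntegral.integral_of_le ht, ← integral_Icc_eq_integral_Ioc] at hFTC
    have hneg : ∫ r in Icc T t, σ (p x r) * (σ (p x r) - meanStress σ p r) =
        -∫ r in Icc T t, σ (p x r) * (meanStress σ p r - σ (p x r)) := by
      rw [← integral_neg]
      refine integral_congr_ae (Eventually.of_forall fun r => ?_)
      simp only; ring
    rw [hneg, hFTC]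
    have a1 := abs_le.1 (hC' _ (hx T le_rfl))
    have a2 := abs_le.1 (hC' _ (hx t ht))
    linarith [a1.2, a2.1]
  rw [e1, e2, sub_zero]
  exact e3.trans_eq (by simp)

/-- At almost every point the stress approaches the mean stress. -/
theorem tendsto_stress_sub_meanStress (hσ : StressAssumptions σ) (hC : ContDiffOn ℝ 1 σ (Ioi 0))
    (hμ : 0 < μ) (hp : IsRegularFlow σ μ p T ε K Λ) :
    ∀ᵐ x ∂unitMeasure, Tendsto (fun t => σ (p x t) - meanStress σ p t) atTop (𝓝 0) := by
  obtain ⟨C, hCb⟩ := hp.exists_dissipation_bound hσ hC hμ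
  set F : ℕ → ℝ → ENNReal := fun n x =>
    ENNReal.ofReal (∫ r in Icc T (T + n), (σ (p x r) - meanStress σ p r) ^ 2) with hF
  have hTn : ∀ n : ℕ, T ≤ T + n := fun n => by simp
  have hcont : ∀ᵐ x ∂unitMeasure,
      ContinuousOn (fun r => (σ (p x r) - meanStress σ p r) ^ 2) (Ici T) := by
    filter_upwards [hp.lip_stress] with x hl
    exact ((continuousOn_of_abs_le hl).sub hp.continuousOn_meanStress).pow 2
  have hmono : ∀ᵐ x ∂unitMeasure, Monotone fun n => F n x := by
    filter_upwards [hcont] with x hx n m hnm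
    refine ENNReal.ofReal_le_ofReal (setIntegral_mono_set ?_ ?_ ?_)
    · exact (hx.mono Icc_subset_Ici_self).integrableOn_Icc
    · exact Eventually.of_forall fun r => sq_nonneg _
    · exact (Icc_subset_Icc_right (by gcongr)).eventuallyLE
  have hmeas : ∀ n, AEMeasurable (F n) unitMeasure := fun n =>
    ((hCb _ (hTn n)).1.aestronglyMeasurable.aemeasurable).ennreal_ofReal
  have hle : ∫⁻ x, ⨆ n, F n x ∂unitMeasure ≤ ENNReal.ofReal C := by
    rw [lintegral_iSup' hmeas hmono]
    refine iSup_le fun n => ?_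
    rw [hF, ← ofReal_integral_eq_lintegral_ofReal (hCb _ (hTn n)).1
      (Eventually.of_forall fun x => integral_nonneg fun r => sq_nonneg _)]
    exact ENNReal.ofReal_le_ofReal (hCb _ (hTn n)).2
  have hfin := ae_lt_top' (AEMeasurable.iSup hmeas) (hle.trans_lt ENNReal.ofReal_lt_top).ne
  filter_upwards [hfin, hcont, hp.lip_stress] with x hx hxc hl
  -- Freezing times before `T` makes the function Lipschitz on the whole line.
  set f : ℝ → ℝ := fun r => σ (p x (max r T)) - meanStress σ p (max r T) with hf
  have hlip : LipschitzWith (2 * Λ).toNNReal f := by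
    refine LipschitzWith.of_dist_le_mul fun a b => ?_
    rw [Real.dist_eq, Real.dist_eq, Real.coe_toNNReal _ (by linarith [hp.lip_nonneg])]
    have h1 := hl (max b T) (max a T) (le_max_right _ _) (le_max_right _ _)
    have h2 := hp.lip_mean (max b T) (max a T) (le_max_right _ _) (le_max_right _ _)
    have h3 : Λ * |max a T - max b T| ≤ Λ * |a - b| :=
      mul_le_mul_of_nonneg_left (abs_max_sub_max_le_abs a b T) hp.lip_nonneg
    calc |f a - f b| = |(σ (p x (max a T)) - σ (p x (max b T))) -
          (meanStress σ p (max a T) - meanStress σ p (max b T))| := by rw [hf]; ring_nf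
      _ ≤ _ := abs_sub _ _
      _ ≤ 2 * Λ * |a - b| := by linarith
  have hB : ∀ t, T ≤ t → ∫ r in T..t, f r ^ 2 ≤ (⨆ n, F n x).toReal := by
    intro t ht
    obtain ⟨n, hn⟩ := exists_nat_ge (t - T)
    have h1 : ∫ r in T..t, f r ^ 2 ≤
        ∫ r in Icc T (T + n), (σ (p x r) - meanStress σ p r) ^ 2 := by
      rw [intervalIntegral.integral_of_le ht, ← integral_Icc_eq_integral_Ioc]
      have : ∫ r in Icc T t, f r ^ 2 =
          ∫ r in Icc T t, (σ (p x r) - meanStress σ p r) ^ 2 :=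
        setIntegral_congr_fun measurableSet_Icc fun r hr => by simp [hf, max_eq_left hr.1]
      rw [this]
      refine setIntegral_mono_set ?_ ?_ ?_
      · exact (hxc.mono Icc_subset_Ici_self).integrableOn_Icc
      · exact Eventually.of_forall fun r => sq_nonneg _
      · exact (Icc_subset_Icc_right (by linarith)).eventuallyLE
    refine h1.trans ?_
    rw [← ENNReal.ofReal_le_iff_le_toReal hx.ne]
    exact le_iSup (fun n => F n x) n
  refine (hlip.tendsto_zero_of_integral_sq_le hB).congr' ?_
  filter_upwards [eventually_ge_atTop T] with t ht
  simp [hf, max_eq_left ht]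

end IsRegularFlow

end QuasistaticVisco

/-! ### Inverse branches of the stress away from critical values -/

theorem HasDerivAt.eventually_slope_mul_pos {f : ℝ → ℝ} {d z : ℝ} (h : HasDerivAt f d z)
    (hd : d ≠ 0) : ∃ δ > 0, ∀ y, y ≠ z → |y - z| < δ → 0 < (f y - f z) * (y - z) * d := by
  have h1 := (hasDerivAt_iff_tendsto_slope.1 h).mul_const d
  have h2 := h1.eventually (lt_mem_nhds (mul_self_pos.2 hd))
  rw [eventually_nhdsWithin_iff, Metric.eventually_nhds_iff] at h2
  obtain ⟨δ, hδ, h3⟩ := h2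
  refine ⟨δ, hδ, fun y hy hlt => ?_⟩
  have h4 := h3 (show dist y z < δ from hlt) hy
  rw [slope_def_field] at h4
  have h5 : 0 < (y - z) ^ 2 := by
    have := sub_ne_zero.2 hy
    positivity
  have h6 := mul_pos h4 h5
  have : (f y - f z) / (y - z) * d * (y - z) ^ 2 = (f y - f z) * (y - z) * d := by
    have := sub_ne_zero.2 hy
    field_simp
  rwa [this] at h6

/-- At a noncritical point, the connected component of a set containing all nearby points with
smaller values contains a point with a smaller value. -/
theorem HasDerivAt.exists_mem_connectedComponentIn_lt {f : ℝ → ℝ} {d w : ℝ} {V : Set ℝ}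
    (h : HasDerivAt f d w) (hd : d ≠ 0) (hV : ∀ᶠ z in 𝓝 w, f z ≤ f w → z ∈ V) :
    ∃ z ∈ connectedComponentIn V w, f z < f w := by
  obtain ⟨δ, hδ, hs⟩ := h.eventually_slope_mul_pos hd
  obtain ⟨δ', hδ', hV'⟩ := Metric.eventually_nhds_iff.1 hV
  set e := min δ δ' / 2 with he
  have he0 : 0 < e := half_pos (lt_min hδ hδ')
  have heδ : e < δ := (half_lt_self (lt_min hδ hδ')).trans_le (min_le_left _ _)
  have heδ' : e < δ' := (half_lt_self (lt_min hδ hδ')).trans_le (min_le_right _ _)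
  -- Move from `w` in the decreasing direction: values stay at most `f w`, so the whole segment lies
  -- in `V`, hence in the component.
  rcases lt_or_gt_of_ne hd with hneg | hpos
  · have hlt : ∀ y, w < y → y ≤ w + e → f y < f w := fun y h1 h2 => by
      have := hs y h1.ne' (by rw [abs_of_pos (sub_pos.2 h1)]; linarith)
      by_contra! hcon
      have := mul_nonneg (mul_nonneg (sub_nonneg.2 hcon) (sub_pos.2 h1).le) (neg_nonneg.2 hneg.le)
      linarith
    have hsub : Icc w (w + e) ⊆ V := fun y hy => by
      refine hV' (by rw [Real.dist_eq, abs_of_nonneg (sub_nonneg.2 hy.1)]; linarith [hy.2]) ?_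
      rcases hy.1.eq_or_lt with rfl | h1
      · rfl
      · exact (hlt y h1 hy.2).le
    exact ⟨w + e, isPreconnected_Icc.subset_connectedComponentIn (left_mem_Icc.2 (by linarith)) hsub
      (right_mem_Icc.2 (by linarith)), hlt _ (by linarith) le_rfl⟩
  · have hlt : ∀ y, y < w → w - e ≤ y → f y < f w := fun y h1 h2 => by
      have := hs y h1.ne (by rw [abs_of_neg (sub_neg.2 h1)]; linarith)
      by_contra! hcon
      have := mul_nonneg (mul_nonneg (sub_nonneg.2 hcon) (sub_pos.2 h1).le) hpos.le
      linarith
    have hsub : Icc (w - e) w ⊆ V := fun y hy => by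
      refine hV' (by rw [Real.dist_eq, abs_of_nonpos (sub_nonpos.2 hy.2)]; linarith [hy.1]) ?_
      rcases hy.2.eq_or_lt with rfl | h1
      · rfl
      · exact (hlt y h1 hy.1).le
    exact ⟨w - e, isPreconnected_Icc.subset_connectedComponentIn (right_mem_Icc.2 (by linarith)) hsub
      (left_mem_Icc.2 (by linarith)), hlt _ (by linarith) le_rfl⟩

theorem IsCompact.continuousOn_invFunOn {f : ℝ → ℝ} {s : Set ℝ} (hs : IsCompact s)
    (hf : ContinuousOn f s) (hinj : InjOn f s) :
    ContinuousOn (Function.invFunOn f s) (f '' s) := by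
  rw [continuousOn_iff_isClosed]
  intro t ht
  refine ⟨f '' (s ∩ t), ((hs.inter_right ht).image_of_continuousOn
    (hf.mono inter_subset_left)).isClosed, ?_⟩
  ext c
  constructor
  · rintro ⟨h1, h2⟩
    exact ⟨⟨_, ⟨Function.invFunOn_mem h2, h1⟩, Function.invFunOn_eq h2⟩, h2⟩
  · rintro ⟨⟨z, hz, rfl⟩, h2⟩
    refine ⟨?_, h2⟩
    rw [mem_preimage, hinj.leftInvOn_invFunOn hz.1]
    exact hz.2

theorem IsClosed.connectedComponentIn_isClosed {V : Set ℝ} (hV : IsClosed V) {z : ℝ} (hz : z ∈ V) :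
    IsClosed (connectedComponentIn V z) := by
  refine isClosed_of_closure_subset ?_
  exact isPreconnected_connectedComponentIn.closure.subset_connectedComponentIn
    (subset_closure (mem_connectedComponentIn hz))
    (hV.closure_subset_iff.2 (connectedComponentIn_subset V z))

namespace QuasistaticVisco

variable {σ : ℝ → ℝ}

theorem hasDerivAt_stress (hC : ContDiffOn ℝ 1 σ (Ioi 0)) {z : ℝ} (hz : 0 < z) :
    HasDerivAt σ (deriv σ z) z :=
  ((hC.differentiableOn (by norm_num)).differentiableAt (Ioi_mem_nhds hz)).hasDerivAt

/-- Preimages of intervals under the stress. -/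
def stressBand (σ : ℝ → ℝ) (α β : ℝ) : Set ℝ := {z | 0 < z ∧ σ z ∈ Icc α β}

/-- The limits `-∞` at `0` and `+∞` at infinity confine the band to some `[δ, R]` with `δ > 0`. -/
theorem isCompact_stressBand (hσ : StressAssumptions σ) (α β : ℝ) :
    IsCompact (stressBand σ α β) := by
  have h1 := hσ.tendsto_zero.eventually_lt_atBot α
  rw [eventually_nhdsWithin_iff, Metric.eventually_nhds_iff] at h1
  obtain ⟨δ, hδ, h1⟩ := h1
  obtain ⟨R, hR⟩ := eventually_atTop.1 (hσ.tendsto_atTop.eventually_gt_atTop β)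
  have : stressBand σ α β = Icc δ R ∩ σ ⁻¹' Icc α β := by
    ext z
    constructor
    · rintro ⟨hz, hzm⟩
      refine ⟨⟨?_, ?_⟩, hzm⟩
      · by_contra! hcon
        exact absurd (h1 (by simpa [abs_of_pos hz] using hcon) hz) (not_lt.2 hzm.1)
      · by_contra! hcon
        exact absurd (hR z hcon.le) (not_lt.2 hzm.2)
    · rintro ⟨h2, h3⟩
      exact ⟨hδ.trans_le h2.1, h3⟩
  rw [this]
  exact isCompact_Icc.of_isClosed_subset ((hσ.continuousOn.mono fun z (hz : z ∈ Icc δ R) =>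
    hδ.trans_le hz.1).preimage_isClosed_of_isClosed isClosed_Icc isClosed_Icc) inter_subset_left

theorem deriv_ne_zero_of_mem_stressBand {α β : ℝ} (hd : Disjoint (Icc α β) (σ '' criticalSet σ))
    {z : ℝ} (hz : z ∈ stressBand σ α β) : deriv σ z ≠ 0 := fun h =>
  disjoint_left.1 hd hz.2 ⟨z, ⟨hz.1, h⟩, rfl⟩

/-- Infinitely many roots in a compact band would accumulate at a root, but a nonzero derivative
isolates it. -/
theorem finite_stress_roots (hσ : StressAssumptions σ) (hC : ContDiffOn ℝ 1 σ (Ioi 0)) {c : ℝ}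
    (hc : ∀ z, 0 < z → σ z = c → deriv σ z ≠ 0) : {z | 0 < z ∧ σ z = c}.Finite := by
  by_contra hinf
  obtain ⟨w, hw, hacc⟩ := Set.Infinite.exists_accPt_of_subset_isCompact hinf
    (isCompact_stressBand hσ c c) fun z hz => ⟨hz.1, by simp [hz.2]⟩
  have hwc : σ w = c := by simpa using hw.2
  have hne := (hasDerivAt_stress hC hw.1).eventually_ne (c := c) (hc w hw.1 hwc)
  rw [accPt_iff_frequently_nhdsNE] at hacc
  obtain ⟨z, hz1, hz2⟩ := (hacc.and_eventually hne).exists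
  exact hz2 hz1.2

theorem exists_stress_root (hσ : StressAssumptions σ) {a b c : ℝ} (ha : 0 < a) (hab : a ≤ b)
    (h : (σ a - c) * (σ b - c) ≤ 0) : ∃ z ∈ Icc a b, σ z = c := by
  have hcont : ContinuousOn σ (Icc a b) := hσ.continuousOn.mono fun z hz => ha.trans_le hz.1
  rcases le_total (σ a) c with h1 | h1
  · rcases le_or_gt c (σ b) with h2 | h2
    · exact intermediate_value_Icc hab hcont ⟨h1, h2⟩
    · exact ⟨a, left_mem_Icc.2 hab, by nlinarith⟩
  · rcases le_or_gt (σ b) c with h2 | h2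
    · exact intermediate_value_Icc' hab hcont ⟨h2, h1⟩
    · exact ⟨a, left_mem_Icc.2 hab, by nlinarith⟩

/-- If all roots of `σ = c` are simple, the sign of `σ - c` is determined by the parity of the
number of roots to the left. -/
theorem stress_lt_iff_even_ncard (hσ : StressAssumptions σ) (hC : ContDiffOn ℝ 1 σ (Ioi 0)) {c : ℝ}
    (hc : ∀ z, 0 < z → σ z = c → deriv σ z ≠ 0) (n : ℕ) :
    ∀ x, 0 < x → σ x ≠ c → ({z | 0 < z ∧ σ z = c} ∩ Iio x).ncard = n → (σ x < c ↔ Even n) := by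
  have hfin := finite_stress_roots hσ hC hc
  induction n with
  | zero =>
    intro x hx hxc hcard
    rw [ncard_eq_zero (hfin.inter_of_left _)] at hcard
    simp only [Even.zero, iff_true]
    by_contra! hcon
    -- With no root to the left of `x`, the sign at `x` is the one near `0`, where `σ < c`.
    have h1 := hσ.tendsto_zero.eventually_lt_atBot c
    obtain ⟨a, ha, ha0, hax⟩ := (h1.and (Ioo_mem_nhdsGT hx)).exists
    obtain ⟨z, hz, hzc⟩ := exists_stress_root hσ ha0 hax.le (c := c)
      (mul_nonpos_of_nonpos_of_nonneg (by linarith) (by linarith))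
    have hzx : z ≠ x := fun h => hxc (h ▸ hzc)
    have : z ∈ ({z | 0 < z ∧ σ z = c} ∩ Iio x) :=
      ⟨⟨ha0.trans_le hz.1, hzc⟩, lt_of_le_of_ne hz.2 hzx⟩
    rw [hcard] at this
    exact this
  | succ n ih =>
    intro x hx hxc hcard
    have hfinx := hfin.inter_of_left (Iio x)
    have hne : ({z | 0 < z ∧ σ z = c} ∩ Iio x).Nonempty := by
      rw [← ncard_pos hfinx, hcard]; exact Nat.succ_pos n
    obtain ⟨z, hz, hmax⟩ := hfinx.exists_maximal hne
    have hmax' : ∀ y, 0 < y → σ y = c → y < x → y ≤ z := fun y h1 h2 h3 => by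
      by_contra! hcon
      exact absurd (hmax (show y ∈ _ from ⟨⟨h1, h2⟩, h3⟩) hcon.le) (not_le.2 hcon)
    obtain ⟨⟨hz0, hzc⟩, hzx⟩ := hz
    rw [mem_Iio] at hzx
    obtain ⟨δ, hδ, hs⟩ := (hasDerivAt_stress hC hz0).eventually_slope_mul_pos (hc z hz0 hzc)
    -- Around the last root `z` before `x`: `σ - c` changes sign between `z - e` and `z + e` and
    -- keeps it up to `x`, while `z - e` is positive and has exactly one root fewer to its left.
    set e := min (min (δ / 2) (z / 2)) (x - z) with he
    have he0 : 0 < e := lt_min (lt_min (half_pos hδ) (half_pos hz0)) (sub_pos.2 hzx)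
    have heδ : e < δ := ((min_le_left _ _).trans (min_le_left _ _)).trans_lt (half_lt_self hδ)
    have hez : e < z := ((min_le_left _ _).trans (min_le_right _ _)).trans_lt (half_lt_self hz0)
    have hex : e ≤ x - z := min_le_right _ _
    have hleft : ∀ y, z - e ≤ y → y < z → σ y ≠ c := fun y h1 h2 h3 => by
      have := hs y h2.ne (by rw [abs_of_neg (sub_neg.2 h2)]; linarith)
      rw [h3, hzc] at this
      simp at this
    have hl := hs (z - e) (by linarith) (by rw [abs_lt]; constructor <;> linarith)
    have hr := hs (z + e) (by linarith) (by rw [abs_lt]; constructor <;> linarith)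
    have hright : 0 < (σ (z + e) - c) * (σ x - c) := by
      by_contra! hcon
      obtain ⟨y, hy, hyc⟩ := exists_stress_root hσ (by linarith) (by linarith) hcon
      have hyx : y ≠ x := fun h => hxc (h ▸ hyc)
      linarith [hmax' y (by linarith [hy.1]) hyc (lt_of_le_of_ne hy.2 hyx), hy.1]
    have hopp : (σ (z - e) - c) * (σ x - c) < 0 := by
      rw [hzc] at hl hr
      have h1 : 0 < ((σ (z - e) - c) * (z - e - z) * deriv σ z) *
          ((σ (z + e) - c) * (z + e - z) * deriv σ z) := mul_pos hl hr
      have h2 : ((σ (z - e) - c) * (z - e - z) * deriv σ z) *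
          ((σ (z + e) - c) * (z + e - z) * deriv σ z) =
          -((σ (z - e) - c) * (σ (z + e) - c)) * (e * deriv σ z) ^ 2 := by ring
      rw [h2] at h1
      have h3 : (σ (z - e) - c) * (σ (z + e) - c) < 0 := by
        have := pos_of_mul_pos_left h1 (sq_nonneg _)
        linarith
      by_contra! hcon
      have h4 : 0 ≤ ((σ (z - e) - c) * (σ (z + e) - c)) * (σ x - c) ^ 2 := by
        have := mul_nonneg hcon hright.le
        calc (0 : ℝ) ≤ _ := this
          _ = _ := by ring
      have h5 : 0 < (σ x - c) ^ 2 := by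
        have := sub_ne_zero.2 hxc
        positivity
      exact absurd (mul_neg_of_neg_of_pos h3 h5) (not_lt.2 h4)
    have hset : {z | 0 < z ∧ σ z = c} ∩ Iio (z - e) = ({z | 0 < z ∧ σ z = c} ∩ Iio x) \ {z} := by
      ext y
      constructor
      · rintro ⟨h1, h2⟩
        rw [mem_Iio] at h2
        exact ⟨⟨h1, mem_Iio.2 (by linarith)⟩, fun h => by rw [mem_singleton_iff] at h; linarith⟩
      · rintro ⟨⟨h1, h2⟩, h3⟩
        refine ⟨h1, ?_⟩
        by_contra hcon
        exact hleft y (not_lt.1 hcon) (lt_of_le_of_ne (hmax' y h1.1 h1.2 h2) h3) h1.2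
    have hcard' : ({z | 0 < z ∧ σ z = c} ∩ Iio (z - e)).ncard = n := by
      have hzmem : z ∈ {z | 0 < z ∧ σ z = c} ∩ Iio x := ⟨⟨hz0, hzc⟩, hzx⟩
      rw [hset, ncard_sdiff_singleton_of_mem hzmem, hcard, Nat.add_sub_cancel]
    have hz'c : σ (z - e) ≠ c := hleft _ le_rfl (by linarith)
    have hih := ih (z - e) (by linarith) hz'c hcard'
    rw [Nat.even_add_one, ← hih]
    constructor
    · intro h1 h2
      nlinarith
    · intro h1
      by_contra! h2
      have h3 : c < σ (z - e) := lt_of_le_of_ne (not_lt.1 h1) hz'c.symm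
      have := mul_nonneg (sub_pos.2 h3).le (sub_nonneg.2 h2)
      linarith

/-- To the right of all roots `σ > c`, so their number cannot be even. -/
theorem odd_ncard_stress_roots (hσ : StressAssumptions σ) (hC : ContDiffOn ℝ 1 σ (Ioi 0)) {c : ℝ}
    (hc : ∀ z, 0 < z → σ z = c → deriv σ z ≠ 0) : Odd {z | 0 < z ∧ σ z = c}.ncard := by
  obtain ⟨x, hx⟩ := eventually_atTop.1 (hσ.tendsto_atTop.eventually_gt_atTop c)
  have hx' := hx (max x 1) (le_max_left _ _)
  have hset : {z | 0 < z ∧ σ z = c} ∩ Iio (max x 1) = {z | 0 < z ∧ σ z = c} := by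
    refine inter_eq_left.2 fun z hz => ?_
    by_contra hcon
    have := hx z ((le_max_left _ _).trans (not_lt.1 hcon))
    exact absurd hz.2 this.ne'
  have h := stress_lt_iff_even_ncard hσ hC hc _ (max x 1) (one_pos.trans_le (le_max_right _ _))
    hx'.ne' rfl
  rw [hset] at h
  rw [← Nat.not_even_iff_odd, ← h]
  exact not_lt.2 hx'.le

/-- On each connected component of a band without critical values, the stress is a bijection onto
the interval of values. -/
theorem bijOn_connectedComponentIn_stressBand (hσ : StressAssumptions σ)
    (hC : ContDiffOn ℝ 1 σ (Ioi 0)) {α β : ℝ} (hd : Disjoint (Icc α β) (σ '' criticalSet σ))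
    {z : ℝ} (hz : z ∈ stressBand σ α β) :
    BijOn σ (connectedComponentIn (stressBand σ α β) z) (Icc α β) := by
  set V := stressBand σ α β with hV
  set J := connectedComponentIn V z with hJ
  have hJV : J ⊆ V := connectedComponentIn_subset V z
  have hJc : IsPreconnected J := isPreconnected_connectedComponentIn
  have hJo : J.OrdConnected := hJc.ordConnected
  have hVc := isCompact_stressBand hσ α β
  have hJk : IsCompact J :=
    hVc.of_isClosed_subset (hVc.isClosed.connectedComponentIn_isClosed hz) hJV
  have hcont : ContinuousOn σ J := hσ.continuousOn.mono fun w hw => (hJV hw).1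
  have hJne : J.Nonempty := ⟨z, mem_connectedComponentIn hz⟩
  refine ⟨fun w hw => (hJV hw).2, ?_, ?_⟩
  -- Rolle: the component is an interval without critical points.
  · have key : ∀ a ∈ J, ∀ b ∈ J, a < b → σ a ≠ σ b := by
      intro a ha b hb hab heq
      have hsub : Icc a b ⊆ J := hJo.out ha hb
      obtain ⟨w, hw, hw0⟩ := exists_deriv_eq_zero hab (hcont.mono hsub) heq
      exact deriv_ne_zero_of_mem_stressBand hd (hJV (hsub (Ioo_subset_Icc_self hw))) hw0
    intro a ha b hb heq
    rcases lt_trichotomy a b with h | h | h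
    · exact absurd heq (key a ha b hb h)
    · exact h
    · exact absurd heq.symm (key b hb a ha h)
  · obtain ⟨u, hu, hmin⟩ := hJk.exists_isMinOn hJne hcont
    obtain ⟨v, hv, hmax⟩ := hJk.exists_isMaxOn hJne hcont
    have hcA : ∀ w ∈ J, ContinuousAt σ w := fun w hw =>
      hσ.continuousOn.continuousAt (Ioi_mem_nhds (hJV hw).1)
    -- If the minimum over the component exceeded `α`, nearby smaller values would still lie in the
    -- band, and the component would contain one of them.
    have huα : σ u = α := by
      by_contra hne
      have hlt : α < σ u := lt_of_le_of_ne (hJV hu).2.1 (Ne.symm hne)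
      obtain ⟨w, hw, hwlt⟩ := (hasDerivAt_stress hC (hJV hu).1).exists_mem_connectedComponentIn_lt
        (V := V) (deriv_ne_zero_of_mem_stressBand hd (hJV hu)) (by
          filter_upwards [Ioi_mem_nhds (hJV hu).1, (hcA u hu).eventually (lt_mem_nhds hlt)]
            with y h1 h2 h3
          exact ⟨h1, h2.le, h3.trans (hJV hu).2.2⟩)
      rw [← connectedComponentIn_eq hu] at hw
      exact absurd (hmin hw) (not_le.2 hwlt)
    have hvβ : σ v = β := by
      by_contra hne
      have hlt : σ v < β := lt_of_le_of_ne (hJV hv).2.2 hne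
      obtain ⟨w, hw, hwlt⟩ :=
        (hasDerivAt_stress hC (hJV hv).1).fun_neg.exists_mem_connectedComponentIn_lt (V := V)
          (neg_ne_zero.2 (deriv_ne_zero_of_mem_stressBand hd (hJV hv))) (by
          filter_upwards [Ioi_mem_nhds (hJV hv).1, (hcA v hv).eventually (gt_mem_nhds hlt)]
            with y h1 h2 h3
          exact ⟨h1, (hJV hv).2.1.trans (neg_le_neg_iff.1 h3), h2.le⟩)
      rw [← connectedComponentIn_eq hv] at hw
      exact absurd (hmax hw) (not_le.2 (neg_lt_neg_iff.1 hwlt))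
    have := hJc.intermediate_value hu hv hcont
    rwa [huα, hvβ] at this

/-- Away from critical values the inverse branches of the stress exist, and their number is odd. -/
theorem exists_isInverseBranches (hσ : StressAssumptions σ) (hC : ContDiffOn ℝ 1 σ (Ioi 0))
    {α β : ℝ} (hαβ : α < β) (hd : Disjoint (Icc α β) (σ '' criticalSet σ)) :
    ∃ (k : ℕ) (g : Fin (2 * k + 1) → ℝ → ℝ), IsInverseBranches σ α β g := by
  set V := stressBand σ α β with hV
  have hα : α ∈ Icc α β := left_mem_Icc.2 hαβ.le
  have hsimple : ∀ z, 0 < z → σ z = α → deriv σ z ≠ 0 := fun z hz hzα =>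
    deriv_ne_zero_of_mem_stressBand hd ⟨hz, by rwa [hzα]⟩
  have hfin := finite_stress_roots hσ hC hsimple
  obtain ⟨k, hk⟩ := odd_ncard_stress_roots hσ hC hsimple
  have : Fintype {z | 0 < z ∧ σ z = α} := hfin.fintype
  have hcard : Fintype.card {z | 0 < z ∧ σ z = α} = 2 * k + 1 := by
    rw [← hk, ← Nat.card_coe_set_eq, Nat.card_eq_fintype_card]
  let r : Fin (2 * k + 1) ≃ {z | 0 < z ∧ σ z = α} := (Fintype.equivFinOfCardEq hcard).symm
  have hrV : ∀ i, (r i : ℝ) ∈ V := fun i => ⟨(r i).2.1, by rw [(r i).2.2]; exact hα⟩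
  -- Every component of the band contains exactly one root of `σ = α`, so the roots index the
  -- components and hence the branches.
  set J : Fin (2 * k + 1) → Set ℝ := fun i => connectedComponentIn V (r i) with hJ
  have hbij : ∀ i, BijOn σ (J i) (Icc α β) := fun i =>
    bijOn_connectedComponentIn_stressBand hσ hC hd (hrV i)
  have hVc := isCompact_stressBand hσ α β
  have hmem : ∀ i, ∀ c ∈ Icc α β, Function.invFunOn σ (J i) c ∈ J i ∧
      σ (Function.invFunOn σ (J i) c) = c := fun i c hc =>
    ⟨Function.invFunOn_mem ((hbij i).surjOn hc), Function.invFunOn_eq ((hbij i).surjOn hc)⟩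
  refine ⟨k, fun i => Function.invFunOn σ (J i), fun i => ?_, fun c hc => ⟨?_, ?_, ?_⟩⟩
  · rw [← (hbij i).image_eq]
    refine IsCompact.continuousOn_invFunOn (hVc.of_isClosed_subset
      (hVc.isClosed.connectedComponentIn_isClosed (hrV i)) (connectedComponentIn_subset _ _))
      (hσ.continuousOn.mono fun w hw => (connectedComponentIn_subset _ _ hw).1) (hbij i).injOn
  · exact fun i _ => ⟨(connectedComponentIn_subset _ _ (hmem i c hc).1).1, (hmem i c hc).2⟩
  · intro i _ j _ hij
    have h1 := connectedComponentIn_eq (hmem i c hc).1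
    have h2 := connectedComponentIn_eq (hmem j c hc).1
    simp only at hij
    rw [hij] at h1
    have hJij : J i = J j := h1.trans h2.symm
    refine r.injective (Subtype.ext ((hbij i).injOn (mem_connectedComponentIn (hrV i)) ?_ ?_))
    · rw [hJij]; exact mem_connectedComponentIn (hrV j)
    · rw [(r i).2.2, (r j).2.2]
  · rintro z ⟨hz, hzc⟩
    have hzV : z ∈ V := ⟨hz, by rwa [hzc]⟩
    obtain ⟨w, hw, hwα⟩ := (bijOn_connectedComponentIn_stressBand hσ hC hd hzV).surjOn hα
    have hwpos : 0 < w := (connectedComponentIn_subset _ _ hw).1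
    obtain ⟨i, hi⟩ := r.surjective ⟨w, hwpos, hwα⟩
    have hJi : J i = connectedComponentIn V z := by
      simp only [hJ, hi]
      exact (connectedComponentIn_eq hw).symm
    refine ⟨i, mem_univ _, (hbij i).injOn (hmem i c hc).1 ?_ ?_⟩
    · rw [hJi]; exact mem_connectedComponentIn hzV
    · rw [(hmem i c hc).2, hzc]

end QuasistaticVisco

/-! ### Passages, Sard's theorem and the nondegeneracy condition -/

/-- A continuous function passing from below `α` to above `β` has a passage on which it takes
values exactly between `α` and `β`. -/
theorem exists_passage {f : ℝ → ℝ} {a b α β : ℝ} (hab : a ≤ b) (hf : ContinuousOn f (Icc a b))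
    (hαβ : α < β) (ha : f a ≤ α) (hb : β ≤ f b) :
    ∃ s e, a ≤ s ∧ s ≤ e ∧ e ≤ b ∧ f s = α ∧ f e = β ∧ MapsTo f (Icc s e) (Icc α β) := by
  have hc1 : IsCompact (Icc a b ∩ f ⁻¹' Ici β) :=
    isCompact_Icc.of_isClosed_subset (hf.preimage_isClosed_of_isClosed isClosed_Icc isClosed_Ici)
      inter_subset_left
  -- `e` is the first time with `f ≥ β`; below, `s` is the last time before `e` with `f ≤ α`.
  obtain ⟨e, ⟨he, heβ⟩, hleast⟩ := hc1.exists_isLeast ⟨b, right_mem_Icc.2 hab, hb⟩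
  have hfe : ContinuousOn f (Icc a e) := hf.mono (Icc_subset_Icc_right he.2)
  have heq : f e = β := by
    obtain ⟨t, ht, htβ⟩ := intermediate_value_Icc he.1 hfe ⟨ha.trans hαβ.le, heβ⟩
    have := hleast ⟨⟨ht.1, ht.2.trans he.2⟩, htβ.ge⟩
    rw [← le_antisymm ht.2 this, htβ]
  have hc2 : IsCompact (Icc a e ∩ f ⁻¹' Iic α) :=
    isCompact_Icc.of_isClosed_subset (hfe.preimage_isClosed_of_isClosed isClosed_Icc isClosed_Iic)
      inter_subset_left
  obtain ⟨s, ⟨hs, hsα⟩, hgreat⟩ := hc2.exists_isGreatest ⟨a, left_mem_Icc.2 he.1, ha⟩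
  have hsq : f s = α := by
    obtain ⟨t, ht, htα⟩ := intermediate_value_Icc hs.2
      (hfe.mono (Icc_subset_Icc_left hs.1)) ⟨hsα, hαβ.le.trans heβ⟩
    have := hgreat ⟨⟨hs.1.trans ht.1, ht.2⟩, htα.le⟩
    rw [← le_antisymm this ht.1, htα]
  refine ⟨s, e, hs.1, hs.2, he.2, hsq, heq, fun t ht => ⟨?_, ?_⟩⟩
  · by_contra! hcon
    have := hgreat ⟨⟨hs.1.trans ht.1, ht.2⟩, hcon.le⟩
    rw [le_antisymm this ht.1, hsq] at hcon
    exact lt_irrefl _ hcon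
  · by_contra! hcon
    have := hleast ⟨⟨hs.1.trans ht.1, ht.2.trans he.2⟩, hcon.le⟩
    rw [le_antisymm ht.2 this, heq] at hcon
    exact lt_irrefl _ hcon

/-- A preconnected set covered by finitely many disjoint closed sets lies in one of them. -/
theorem IsPreconnected.subset_of_finite_closed_cover {X ι : Type*} [TopologicalSpace X] [Finite ι]
    {s : Set X} (hs : IsPreconnected s) {J : ι → Set X} (hJ : ∀ i, IsClosed (J i))
    (hd : ∀ i j, i ≠ j → Disjoint (J i) (J j)) (hcov : s ⊆ ⋃ i, J i) {x : X} (hx : x ∈ s) {i : ι}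
    (hxi : x ∈ J i) : s ⊆ J i := by
  have hcl : IsClosed (⋃ j : {j // j ≠ i}, J j) := isClosed_iUnion_of_finite fun j => hJ j
  have hdis : Disjoint (J i) (⋃ j : {j // j ≠ i}, J j) :=
    disjoint_iUnion_right.2 fun j => hd i j j.2.symm
  rcases (isPreconnected_iff_subset_of_disjoint_closed.1 hs) _ _ (hJ i) hcl (fun y hy => by
    obtain ⟨j, hj⟩ := mem_iUnion.1 (hcov hy)
    by_cases hji : j = i
    · exact Or.inl (hji ▸ hj)
    · exact Or.inr (mem_iUnion.2 ⟨⟨j, hji⟩, hj⟩)) (by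
    rw [hdis.inter_eq, inter_empty]) with h | h
  · exact h
  · exact absurd (h hx) (disjoint_left.1 hdis hxi)

namespace QuasistaticVisco

variable {σ : ℝ → ℝ}

theorem Nondegenerate.volume_image_criticalSet (hN : Nondegenerate σ) :
    volume (σ '' criticalSet σ) = 0 := by
  refine addHaar_image_eq_zero_of_det_fderivWithin_eq_zero volume
    (f' := fun z => ContinuousLinearMap.toSpanSingleton ℝ (deriv σ z))
    (fun z hz => (hasDerivAt_stress hN.contDiff hz.1).hasFDerivAt.hasFDerivWithinAt) fun z hz => ?_
  have : ContinuousLinearMap.toSpanSingleton ℝ (deriv σ z) = 0 := by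
    rw [hz.2]; ext; simp
  rw [this, ContinuousLinearMap.det]
  simp

/-- By Sard's theorem, every interval contains an interval without critical values. -/
theorem Nondegenerate.exists_Icc_disjoint (hσ : StressAssumptions σ) (hN : Nondegenerate σ)
    {a b : ℝ} (hab : a < b) : ∃ y δ : ℝ, 0 < δ ∧ a < y - δ ∧ y + δ < b ∧
      Disjoint (Icc (y - δ) (y + δ)) (σ '' criticalSet σ) := by
  set V := stressBand σ a b with hV
  have hdc : ContinuousOn (deriv σ) V :=
    (hN.contDiff.continuousOn_deriv_of_isOpen isOpen_Ioi le_rfl).mono fun z hz => hz.1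
  have hVc := isCompact_stressBand hσ a b
  -- The critical points with values in `[a,b]` form a compact set, so their values form a closed
  -- null set, and some point of `(a,b)` has a neighbourhood avoiding it.
  have hZ : IsCompact (V ∩ deriv σ ⁻¹' {0}) :=
    hVc.of_isClosed_subset (hdc.preimage_isClosed_of_isClosed hVc.isClosed isClosed_singleton)
      inter_subset_left
  have himg : IsCompact (σ '' (V ∩ deriv σ ⁻¹' {0})) :=
    hZ.image_of_continuousOn (hσ.continuousOn.mono fun z hz => hz.1.1)
  have hnull : volume (σ '' (V ∩ deriv σ ⁻¹' {0})) = 0 :=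
    measure_mono_null (image_mono (show _ ⊆ criticalSet σ from fun z hz => ⟨hz.1.1, hz.2⟩))
      hN.volume_image_criticalSet
  obtain ⟨y, hy, hyn⟩ : ∃ y ∈ Ioo a b, y ∉ σ '' (V ∩ deriv σ ⁻¹' {0}) := by
    by_contra! hcon
    have := measure_mono_null (show Ioo a b ⊆ _ from hcon) hnull
    rw [Real.volume_Ioo, ENNReal.ofReal_eq_zero] at this
    linarith
  have hopen : Ioo a b ∩ (σ '' (V ∩ deriv σ ⁻¹' {0}))ᶜ ∈ 𝓝 y :=
    (isOpen_Ioo.inter himg.isClosed.isOpen_compl).mem_nhds ⟨hy, hyn⟩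
  obtain ⟨δ, hδ, hball⟩ := Metric.nhds_basis_closedBall.mem_iff.1 hopen
  rw [Real.closedBall_eq_Icc] at hball
  have h1 := (hball (left_mem_Icc.2 (by linarith))).1.1
  have h2 := (hball (right_mem_Icc.2 (by linarith))).1.2
  refine ⟨y, δ, hδ, h1, h2, disjoint_left.2 ?_⟩
  rintro _ hc ⟨z, hz, rfl⟩
  exact (hball hc).2 ⟨z, ⟨⟨hz.1, h1.le.trans hc.1, hc.2.trans h2.le⟩, hz.2⟩, rfl⟩

namespace IsInverseBranches

variable {α β : ℝ} {n : ℕ} {g : Fin n → ℝ → ℝ}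

theorem pos (hg : IsInverseBranches σ α β g) {c : ℝ} (hc : c ∈ Icc α β) (i : Fin n) :
    0 < g i c := ((hg.2 c hc).mapsTo (mem_univ i)).1

theorem stress_eq (hg : IsInverseBranches σ α β g) {c : ℝ} (hc : c ∈ Icc α β) (i : Fin n) :
    σ (g i c) = c := ((hg.2 c hc).mapsTo (mem_univ i)).2

theorem mono (hg : IsInverseBranches σ α β g) {α' β' : ℝ} (h : Icc α' β' ⊆ Icc α β) :
    IsInverseBranches σ α' β' g :=
  ⟨fun i => (hg.1 i).mono h, fun c hc => hg.2 c (h hc)⟩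

theorem exists_eq (hg : IsInverseBranches σ α β g) {z : ℝ} (hz : 0 < z) (hzc : σ z ∈ Icc α β) :
    ∃ i, g i (σ z) = z := by
  obtain ⟨i, -, hi⟩ := (hg.2 _ hzc).surjOn ⟨hz, rfl⟩
  exact ⟨i, hi⟩

theorem disjoint_image (hg : IsInverseBranches σ α β g) {i j : Fin n} (hij : i ≠ j) :
    Disjoint (g i '' Icc α β) (g j '' Icc α β) := by
  rw [disjoint_left]
  rintro _ ⟨c, hc, rfl⟩ ⟨d, hd, hcd⟩
  have h1 : d = c := by rw [← hg.stress_eq hd j, hcd, hg.stress_eq hc i]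
  subst h1
  exact hij ((hg.2 d hd).injOn (mem_univ i) (mem_univ j) hcd.symm)

theorem isClosed_image (hg : IsInverseBranches σ α β g) (i : Fin n) :
    IsClosed (g i '' Icc α β) := (isCompact_Icc.image_of_continuousOn (hg.1 i)).isClosed

theorem hasDerivAt (hg : IsInverseBranches σ α β g) (hC : ContDiffOn ℝ 1 σ (Ioi 0))
    (hd : Disjoint (Icc α β) (σ '' criticalSet σ)) {c : ℝ} (hc : c ∈ Ioo α β) (i : Fin n) :
    HasDerivAt (g i) (deriv σ (g i c))⁻¹ c := by
  have hc' := Ioo_subset_Icc_self hc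
  have hnhds := Icc_mem_nhds hc.1 hc.2
  refine HasDerivAt.of_local_left_inverse ((hg.1 i).continuousAt hnhds)
    (hasDerivAt_stress hC (hg.pos hc' i)) ?_ ?_
  · exact deriv_ne_zero_of_mem_stressBand hd ⟨hg.pos hc' i, by rwa [hg.stress_eq hc' i]⟩
  · filter_upwards [hnhds] with y hy using hg.stress_eq hy i

end IsInverseBranches

/-- Under the nondegeneracy condition, no nontrivial combination of the inverse branches is
constant. -/
theorem Nondegenerate.coeff_eq_zero (hN : Nondegenerate σ) {α β α' β' : ℝ} {k : ℕ}
    {g : Fin (2 * k + 1) → ℝ → ℝ} (hd : Disjoint (Icc α β) (σ '' criticalSet σ))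
    (hg : IsInverseBranches σ α β g) (h1 : α < α') (h2 : α' < β') (h3 : β' < β)
    {l : Fin (2 * k + 1) → ℝ} {μ : ℝ} (hl : ∀ c ∈ Icc α' β', ∑ i, l i * g i c = μ) (i) :
    l i = 0 := by
  -- Strictly inside `[α, β]` the branches are differentiable, so the constant combination can be
  -- differentiated.
  have hsub : Icc α' β' ⊆ Ioo α β := fun c hc => ⟨h1.trans_le hc.1, hc.2.trans_lt h3⟩
  have hLI := hN.linearIndependent α' β' h2 (hd.mono_left (hsub.trans Ioo_subset_Icc_self)) k g
    (hg.mono (hsub.trans Ioo_subset_Icc_self))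
  refine Fintype.linearIndependent_iff.1 hLI l ?_ i
  ext ⟨c, hc⟩
  have hu := uniqueDiffOn_Icc h2 c hc
  have hder : ∀ j, HasDerivWithinAt (g j) (derivWithin (g j) (Icc α' β') c) (Icc α' β') c :=
    fun j => (hg.hasDerivAt hN.contDiff hd (hsub hc) j).differentiableAt.differentiableWithinAt
      |>.hasDerivWithinAt
  have hsum : HasDerivWithinAt (fun y => ∑ j, l j * g j y)
      (∑ j, l j * derivWithin (g j) (Icc α' β') c) (Icc α' β') c :=
    HasDerivWithinAt.fun_sum fun j _ => (hder j).const_mul (l j)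
  have hconst : HasDerivWithinAt (fun y => ∑ j, l j * g j y) 0 (Icc α' β') c :=
    (hasDerivWithinAt_const c _ μ).congr hl (hl c hc)
  have := hu.eq_deriv _ hsum hconst
  simpa [Finset.sum_apply] using this

/-- The level sets of a stress with null critical set have empty interior. -/
theorem Nondegenerate.dense_stress_ne (hN : Nondegenerate σ) (C : ℝ) :
    Dense {z | 0 < z → σ z ≠ C} := by
  rw [← compl_compl {z | 0 < z → σ z ≠ C}, ← interior_eq_empty_iff_dense_compl]
  by_contra! hne
  set U := interior ({z | 0 < z → σ z ≠ C}ᶜ) with hU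
  -- On an open part of a level set the derivative vanishes, so `U` would be a nonempty open null
  -- set.
  have hsub : U ⊆ criticalSet σ := by
    intro z hz
    have hz' : ∀ w ∈ U, 0 < w ∧ σ w = C := fun w hw => by
      simpa using interior_subset hw
    refine ⟨(hz' z hz).1, ?_⟩
    have : σ =ᶠ[𝓝 z] fun _ => C := by
      filter_upwards [isOpen_interior.mem_nhds hz] with w hw using (hz' w hw).2
    rw [this.deriv_eq, deriv_const]
  exact (isOpen_interior.measure_pos volume hne).ne' (measure_mono_null hsub hN.null_critical)

end QuasistaticVisco

/-! ### Convergence of the mean stress and of the solution -/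

namespace QuasistaticVisco

variable {σ : ℝ → ℝ} {μ : ℝ} {p : ℝ → ℝ → ℝ} {T ε K Λ : ℝ}

/-- If the forcing converges to `C`, a level `a` with `σ a ≠ C` is crossed only finitely often. -/
theorem not_frequently_crossing {u m : ℝ → ℝ} {C a : ℝ} (hu : ContinuousOn u (Ici T))
    (hd : ∀ t, T < t → HasDerivAt u (m t - σ (u t)) t) (hm : Tendsto m atTop (𝓝 C))
    (ha : σ a ≠ C) : ¬ ((∃ᶠ t in atTop, u t < a) ∧ ∃ᶠ t in atTop, a < u t) := by
  rintro ⟨h1, h2⟩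
  -- If `σ a < C`, then `u' > 0` whenever `u = a` at late times, so `u` cannot come back below `a`;
  -- the other case is symmetric.
  rcases lt_or_gt_of_ne ha with h | h
  · obtain ⟨N, hN⟩ := eventually_atTop.1 (hm.eventually (lt_mem_nhds h))
    obtain ⟨s, hs, hsa⟩ := frequently_atTop.1 h2 (max N (T + 1))
    obtain ⟨t, ht, hta⟩ := frequently_atTop.1 h1 s
    have hsT : T < s := by linarith [(le_max_right N (T + 1)).trans hs]
    have hsN : N ≤ s := (le_max_left N (T + 1)).trans hs
    have := image_le_of_deriv_right_lt_deriv_boundary (f := fun r => -u r)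
      (f' := fun r => -(m r - σ (u r))) (a := s) (b := t) (B := fun _ => -a) (B' := fun _ => 0)
      ((hu.mono fun r hr => hsT.le.trans hr.1).neg)
      (fun r hr => (hd r (hsT.trans_le hr.1)).neg.hasDerivWithinAt) (by simpa using hsa.le)
      (fun r => hasDerivAt_const _ _) (fun r hr heq => by
        have e : u r = a := neg_injective heq
        have := hN r (hsN.trans hr.1)
        rw [e]; linarith) (right_mem_Icc.2 ht)
    linarith
  · obtain ⟨N, hN⟩ := eventually_atTop.1 (hm.eventually (gt_mem_nhds h))
    obtain ⟨s, hs, hsa⟩ := frequently_atTop.1 h1 (max N (T + 1))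
    obtain ⟨t, ht, hta⟩ := frequently_atTop.1 h2 s
    have hsT : T < s := by linarith [(le_max_right N (T + 1)).trans hs]
    have hsN : N ≤ s := (le_max_left N (T + 1)).trans hs
    have := image_le_of_deriv_right_lt_deriv_boundary (f := u)
      (f' := fun r => m r - σ (u r)) (a := s) (b := t) (B := fun _ => a) (B' := fun _ => 0)
      (hu.mono fun r hr => hsT.le.trans hr.1)
      (fun r hr => (hd r (hsT.trans_le hr.1)).hasDerivWithinAt) hsa.le
      (fun r => hasDerivAt_const _ _) (fun r hr heq => by
        have := hN r (hsN.trans hr.1)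
        rw [heq]; linarith) (right_mem_Icc.2 ht)
    linarith

namespace IsRegularFlow

/-- If the mean stress converges, the solution converges to an equilibrium. -/
theorem exists_equilibrium_of_tendsto (hσ : StressAssumptions σ) (hN : Nondegenerate σ)
    (hμ : 0 < μ) (hp : IsRegularFlow σ μ p T ε K Λ) {C : ℝ}
    (hm : Tendsto (meanStress σ p) atTop (𝓝 C)) :
    ∃ pbar : ℝ → ℝ, IsEquilibrium σ μ pbar ∧
      Tendsto (fun t => eLpNorm (fun x => p x t - pbar x) 2 unitMeasure) atTop (𝓝 0) := by
  have hlim : ∀ᵐ x ∂unitMeasure, ∃ z, Tendsto (p x) atTop (𝓝 z) := by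
    filter_upwards [hp.bounds, hp.continuousOn, hp.deriv] with x hx hc hd
    refine tendsto_of_no_upcrossings (hN.dense_stress_ne C) ?_
      ⟨K, eventually_map.2 ((eventually_ge_atTop T).mono fun t ht => (hx t ht).2)⟩
      ⟨ε, eventually_map.2 ((eventually_ge_atTop T).mono fun t ht => (hx t ht).1)⟩
    rintro a ha b - hab ⟨h1, h2⟩
    have ha0 : 0 < a := by
      obtain ⟨t, ht, hlt⟩ := frequently_atTop.1 h1 T
      exact (hp.eps_pos.trans_le (hx t ht).1).trans hlt
    exact not_frequently_crossing hc hd hm (ha ha0) ⟨h1, h2.mono fun t ht => hab.trans ht⟩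
  set pbar : ℝ → ℝ := fun x => limUnder atTop (p x) with hpbar
  have hconv : ∀ᵐ x ∂unitMeasure, Tendsto (p x) atTop (𝓝 (pbar x)) := by
    filter_upwards [hlim] with x hx using tendsto_nhds_limUnder hx
  have hbar : ∀ᵐ x ∂unitMeasure, pbar x ∈ Icc ε K := by
    filter_upwards [hconv, hp.bounds] with x hx hb
    exact isClosed_Icc.mem_of_tendsto hx ((eventually_ge_atTop T).mono fun t ht => hb t ht)
  have hTn : Tendsto (fun n : ℕ => T + n) atTop atTop :=
    tendsto_atTop_add_const_left _ _ tendsto_natCast_atTop_atTop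
  have hmeas : AEMeasurable pbar unitMeasure := by
    refine aemeasurable_of_tendsto_metrizable_ae' (f := fun (n : ℕ) x => p x (T + n))
      (fun n => hp.flow.aemeasurable_slice (by linarith [hp.one_le, n.cast_nonneg (α := ℝ)])) ?_
    filter_upwards [hconv] with x hx using hx.comp hTn
  have hLp : MemLp pbar 2 unitMeasure := by
    refine MemLp.of_bound hmeas.aestronglyMeasurable K ?_
    filter_upwards [hbar] with x hx
    rw [Real.norm_of_nonneg (hp.eps_pos.le.trans hx.1)]
    exact hx.2
  have hsl : ∀ᶠ t in atTop, AEStronglyMeasurable (fun x => p x t) unitMeasure := by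
    filter_upwards [eventually_ge_atTop T] with t ht
    exact (hp.flow.memLp t (hp.one_le.trans ht)).aestronglyMeasurable
  have hmass : ∫ x, pbar x ∂unitMeasure = μ := by
    have h1 : Tendsto (fun t => ∫ x, p x t ∂unitMeasure) atTop (𝓝 (∫ x, pbar x ∂unitMeasure)) := by
      refine tendsto_integral_filter_of_dominated_convergence (fun _ => K) hsl ?_
        (integrable_const _) hconv
      filter_upwards [eventually_ge_atTop T] with t ht
      filter_upwards [hp.bounds] with x hx
      rw [Real.norm_of_nonneg (hp.eps_pos.le.trans (hx t ht).1)]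
      exact (hx t ht).2
    refine tendsto_nhds_unique h1 (tendsto_const_nhds.congr' ?_)
    filter_upwards [eventually_ge_atTop T] with t ht
    exact (hp.flow.mass t (hp.one_le.trans ht)).symm
  have hstress : ∀ᵐ x ∂unitMeasure, σ (pbar x) = C := by
    filter_upwards [hconv, hbar, hp.tendsto_stress_sub_meanStress hσ hN.contDiff hμ] with x h1 h2 h3
    have h4 : Tendsto (fun t => σ (p x t)) atTop (𝓝 (σ (pbar x))) :=
      ((hσ.continuousOn.continuousAt (Ioi_mem_nhds (hp.eps_pos.trans_le h2.1))).tendsto).comp h1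
    have h5 := h3.add hm
    simp only [sub_add_cancel, zero_add] at h5
    exact tendsto_nhds_unique h4 h5
  refine ⟨pbar, ⟨hLp, ?_, ⟨C, hstress⟩, hmass⟩, ?_⟩
  · filter_upwards [hbar] with x hx using hp.eps_pos.trans_le hx.1
  have hsq : Tendsto (fun t => ∫ x, (p x t - pbar x) ^ 2 ∂unitMeasure) atTop (𝓝 0) := by
    have : (0 : ℝ) = ∫ _x, (0 : ℝ) ∂unitMeasure := by simp
    rw [this]
    refine tendsto_integral_filter_of_dominated_convergence (fun _ => K ^ 2) ?_ ?_
      (integrable_const _) ?_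
    · filter_upwards [hsl] with t ht using (ht.sub hLp.aestronglyMeasurable).pow 2
    · filter_upwards [eventually_ge_atTop T] with t ht
      filter_upwards [hp.bounds, hbar] with x hx hb
      rw [Real.norm_of_nonneg (sq_nonneg _), ← sq_abs]
      have h1 := hx t ht
      have := hp.eps_pos
      exact pow_le_pow_left₀ (abs_nonneg _) (abs_le.2 ⟨by linarith [h1.1, hb.2],
        by linarith [h1.2, hb.1]⟩) 2
    · filter_upwards [hconv] with x hx
      simpa using (hx.sub_const (pbar x)).pow 2
  have hsqrt := (ENNReal.tendsto_ofReal (hsq.rpow_const (p := 1 / 2) (Or.inr (by norm_num))))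
  rw [Real.zero_rpow (by norm_num), ENNReal.ofReal_zero] at hsqrt
  refine hsqrt.congr' ?_
  filter_upwards [eventually_ge_atTop T] with t ht
  have hmem := (hp.flow.memLp t (hp.one_le.trans ht)).sub hLp
  have := hmem.eLpNorm_eq_integral_rpow_norm (by norm_num) (by norm_num)
  simp only [ENNReal.toReal_ofNat, Pi.sub_apply, Real.norm_eq_abs, Real.rpow_ofNat, sq_abs] at this
  rw [one_div, ← this]
  rfl

/-- During a passage of the mean stress almost every point eventually stays on one branch. -/
theorem eventually_exists_branch (hσ : StressAssumptions σ) (hC : ContDiffOn ℝ 1 σ (Ioi 0))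
    (hμ : 0 < μ) (hp : IsRegularFlow σ μ p T ε K Λ) {α β α' β' : ℝ} {n : ℕ} {g : Fin n → ℝ → ℝ}
    (hg : IsInverseBranches σ α β g) (h1 : α < α') (h3 : β' < β) :
    ∀ᵐ x ∂unitMeasure, ∀ᶠ N in atTop, ∀ s e, N ≤ s → s ≤ e →
      MapsTo (meanStress σ p) (Icc s e) (Icc α' β') →
      ∃ i, ∀ t ∈ Icc s e, σ (p x t) ∈ Icc α β ∧ p x t = g i (σ (p x t)) := by
  filter_upwards [hp.tendsto_stress_sub_meanStress hσ hC hμ, hp.bounds, hp.continuousOn]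
    with x hx hb hc
  -- The margins between the two intervals absorb `σ(p) - m`, so `σ(p)` stays in `[α, β]`. The
  -- threshold depends on `x` but not on the passage.
  have hev := hx.eventually (Ioo_mem_nhds (show α - α' < 0 by linarith) (show 0 < β - β' by linarith))
  obtain ⟨N₀, hN₀⟩ := eventually_atTop.1 hev
  filter_upwards [eventually_ge_atTop (max N₀ T)] with N hN s e hs hse hmaps
  have hNs : N₀ ≤ s := ((le_max_left _ _).trans hN).trans hs
  have hTs : T ≤ s := ((le_max_right _ _).trans hN).trans hs
  have hσm : ∀ t ∈ Icc s e, σ (p x t) ∈ Icc α β := fun t ht => by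
    have h4 := hN₀ t (hNs.trans ht.1)
    have h5 := hmaps ht
    exact ⟨by linarith [h4.1, h5.1], by linarith [h4.2, h5.2]⟩
  have hpos : ∀ t ∈ Icc s e, 0 < p x t := fun t ht =>
    hp.eps_pos.trans_le (hb t (hTs.trans ht.1)).1
  -- The path is connected and covered by the disjoint closed images of the branches, so it lies in
  -- one of them.
  have hpre : IsPreconnected (p x '' Icc s e) :=
    isPreconnected_Icc.image _ (hc.mono fun t ht => hTs.trans ht.1)
  have hcov : p x '' Icc s e ⊆ ⋃ i, g i '' Icc α β := by
    rintro _ ⟨t, ht, rfl⟩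
    obtain ⟨i, hi⟩ := hg.exists_eq (hpos t ht) (hσm t ht)
    exact mem_iUnion.2 ⟨i, σ (p x t), hσm t ht, hi⟩
  have hs0 : p x s ∈ p x '' Icc s e := mem_image_of_mem _ (left_mem_Icc.2 hse)
  obtain ⟨i, hi⟩ := mem_iUnion.1 (hcov hs0)
  have hsub := hpre.subset_of_finite_closed_cover hg.isClosed_image
    (fun i j hij => hg.disjoint_image hij) hcov hs0 hi
  refine ⟨i, fun t ht => ⟨hσm t ht, ?_⟩⟩
  obtain ⟨c, hc, hct⟩ := hsub (mem_image_of_mem _ ht)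
  rw [← hct, hg.stress_eq hc i]

/-- The mean stress converges. -/
theorem exists_tendsto_meanStress (hσ : StressAssumptions σ) (hN : Nondegenerate σ)
    (hμ : 0 < μ) (hp : IsRegularFlow σ μ p T ε K Λ) :
    ∃ C, Tendsto (meanStress σ p) atTop (𝓝 C) := by
  obtain ⟨S, -, hS⟩ := hp.exists_stress_bound hσ
  refine tendsto_of_no_upcrossings dense_univ ?_
    ⟨S, eventually_map.2 ((eventually_ge_atTop T).mono fun t ht => (abs_le.1 (hS t ht)).2)⟩
    ⟨-S, eventually_map.2 ((eventually_ge_atTop T).mono fun t ht => (abs_le.1 (hS t ht)).1)⟩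
  rintro a - b - hab ⟨hfa, hfb⟩
  obtain ⟨y, δ, hδ, hay, hyb, hdis⟩ := hN.exists_Icc_disjoint hσ hab
  obtain ⟨k, g, hg⟩ := exists_isInverseBranches hσ hN.contDiff (by linarith) hdis
  have hm := hp.continuousOn_meanStress
  have hpass : ∀ n : ℕ, ∃ s e, max T n ≤ s ∧ s ≤ e ∧ meanStress σ p s = y - δ / 2 ∧
      meanStress σ p e = y + δ / 2 ∧
      MapsTo (meanStress σ p) (Icc s e) (Icc (y - δ / 2) (y + δ / 2)) := by
    intro n
    obtain ⟨t₁, ht₁, h1⟩ := frequently_atTop.1 hfa (max T n)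
    obtain ⟨t₂, ht₂, h2⟩ := frequently_atTop.1 hfb t₁
    obtain ⟨s, e, hs, hse, -, h3, h4, h5⟩ := exists_passage ht₂
      (hm.mono fun t ht => ((le_max_left _ _).trans ht₁).trans ht.1)
      (show y - δ / 2 < y + δ / 2 by linarith) (by linarith) (by linarith)
    exact ⟨s, e, ht₁.trans hs, hse, h3, h4, h5⟩
  choose s e hsn hse hms hme hmaps using hpass
  have hTs : ∀ n, T ≤ s n := fun n => (le_max_left _ _).trans (hsn n)
  have h1s : ∀ n, 1 ≤ s n := fun n => hp.one_le.trans (hTs n)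
  have hns : Tendsto s atTop atTop :=
    tendsto_atTop_mono (fun n => (le_max_right _ _).trans (hsn n)) tendsto_natCast_atTop_atTop
  -- The points on branch `i` at the start of passage `n`. These sets do not depend on the value `c`
  -- chosen below, so a single limit of their measures serves all `c`.
  set A : ℕ → Fin (2 * k + 1) → Set ℝ := fun n i =>
    {x | p x (s n) ∈ g i '' Icc (y - δ) (y + δ)} with hA
  have hAm : ∀ n i, NullMeasurableSet (A n i) unitMeasure := fun n i =>
    (hp.flow.aemeasurable_slice (h1s n)).nullMeasurableSet_preimage (hg.isClosed_image i).measurableSet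
  have hgood : ∀ᵐ x ∂unitMeasure, ∀ᶠ n in atTop, ∃ i, ∀ t ∈ Icc (s n) (e n),
      σ (p x t) ∈ Icc (y - δ) (y + δ) ∧ p x t = g i (σ (p x t)) := by
    filter_upwards [hp.eventually_exists_branch hσ hN.contDiff hμ hg
      (show y - δ < y - δ / 2 by linarith) (show y + δ / 2 < y + δ by linarith)] with x hx
    filter_upwards [hns.eventually hx] with n hn
    exact hn _ _ le_rfl (hse n) (hmaps n)
  have hτ : ∀ c ∈ Icc (y - δ / 2) (y + δ / 2), ∀ n, ∃ t ∈ Icc (s n) (e n),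
      meanStress σ p t = c := fun c hc n => by
    refine intermediate_value_Icc (hse n) (hm.mono fun t ht => (hTs n).trans ht.1) ?_
    rwa [hms, hme]
  have key : ∀ c ∈ Icc (y - δ / 2) (y + δ / 2),
      Tendsto (fun n => ∑ i, unitMeasure.real (A n i) * g i c) atTop (𝓝 μ) := by
    intro c hc
    -- At these times `m = c`, hence `σ(p(x, t n)) → c`; a point that stays on branch `i` during
    -- passage `n` has `p(x, t n)` close to `g i c`.
    choose t ht htc using hτ c hc
    have hTt : ∀ n, T ≤ t n := fun n => (hTs n).trans (ht n).1
    have htt : Tendsto t atTop atTop := tendsto_atTop_mono (fun n => (ht n).1) hns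
    set h : ℕ → ℝ → ℝ := fun n x => p x (t n) - ∑ i, (A n i).indicator (fun _ => g i c) x with hh
    have hi1 : ∀ n, Integrable (fun x => p x (t n)) unitMeasure := fun n =>
      hp.flow.integrable (hp.one_le.trans (hTt n))
    have hi2 : ∀ n i, Integrable ((A n i).indicator (fun _ => g i c)) unitMeasure := fun n i =>
      (integrable_const _).indicator₀ (hAm n i)
    have hi3 : ∀ n, Integrable (fun x => ∑ i, (A n i).indicator (fun _ => g i c) x) unitMeasure :=
      fun n => integrable_finsetSum _ fun i _ => hi2 n i
    have hhint : ∀ n, ∫ x, h n x ∂unitMeasure = μ - ∑ i, unitMeasure.real (A n i) * g i c := by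
      intro n
      rw [hh]
      simp only
      rw [integral_sub (hi1 n) (hi3 n), hp.flow.mass _ (hp.one_le.trans (hTt n)),
        integral_finsetSum _ fun i _ => hi2 n i]
      congr 1
      refine Finset.sum_congr rfl fun i _ => ?_
      rw [integral_indicator₀ (hAm n i)]
      simp
    have hcIoo : c ∈ Ioo (y - δ) (y + δ) := ⟨by linarith [hc.1], by linarith [hc.2]⟩
    have hlim : ∀ᵐ x ∂unitMeasure, Tendsto (fun n => h n x) atTop (𝓝 0) := by
      filter_upwards [hgood, hp.tendsto_stress_sub_meanStress hσ hN.contDiff hμ] with x hx hq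
      have hσt : Tendsto (fun n => σ (p x (t n))) atTop (𝓝 c) := by
        have := (hq.comp htt).add_const c
        simpa [Function.comp_def, htc] using this
      have hgt : Tendsto (fun n => ∑ i, |g i (σ (p x (t n))) - g i c|) atTop (𝓝 0) := by
        rw [← Finset.sum_const_zero (s := (Finset.univ : Finset (Fin (2 * k + 1))))]
        refine tendsto_finsetSum _ fun i _ => ?_
        have hci : ContinuousAt (g i) c := (hg.1 i).continuousAt (Icc_mem_nhds hcIoo.1 hcIoo.2)
        simpa using ((hci.tendsto.comp hσt).sub_const (g i c)).abs
      refine squeeze_zero_norm' ?_ hgt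
      filter_upwards [hx] with n hn
      obtain ⟨i, hi⟩ := hn
      have hs0 := hi (s n) (left_mem_Icc.2 (hse n))
      have hmem : x ∈ A n i := ⟨_, hs0.1, hs0.2.symm⟩
      have hnot : ∀ j, j ≠ i → x ∉ A n j := fun j hj hj' =>
        disjoint_left.1 (hg.disjoint_image hj) hj' hmem
      have hsum : ∑ j, (A n j).indicator (fun _ => g j c) x = g i c := by
        rw [Finset.sum_eq_single i (fun j _ hj => indicator_of_notMem (hnot j hj) _)
          (fun hcon => absurd (Finset.mem_univ i) hcon), indicator_of_mem hmem]
      rw [hh]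
      simp only
      rw [hsum, Real.norm_eq_abs]
      have heq : |p x (t n) - g i c| = |g i (σ (p x (t n))) - g i c| := by
        rw [← (hi _ (ht n)).2]
      rw [heq]
      exact Finset.single_le_sum (f := fun j => |g j (σ (p x (t n))) - g j c|)
        (fun j _ => abs_nonneg _) (Finset.mem_univ i)
    have hDCT := tendsto_integral_of_dominated_convergence (μ := unitMeasure) (F := h)
      (f := fun _ => 0) (fun _ => K + ∑ i, |g i c|)
      (fun n => ((hi1 n).sub (hi3 n)).aestronglyMeasurable) (integrable_const _) (fun n => by
        filter_upwards [hp.bounds] with x hx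
        have h2 := hx (t n) (hTt n)
        refine (norm_sub_le _ _).trans (add_le_add ?_ ?_)
        · rw [Real.norm_of_nonneg (hp.eps_pos.le.trans h2.1)]; exact h2.2
        · exact (norm_sum_le _ _).trans (Finset.sum_le_sum fun i _ => norm_indicator_le_norm_self _ _))
      hlim
    rw [integral_zero] at hDCT
    simpa [hhint] using hDCT.const_sub μ
  set l : ℕ → Fin (2 * k + 1) → ℝ := fun n i => unitMeasure.real (A n i) with hl
  obtain ⟨L, -, φ, hφ, hL⟩ := (isCompact_Icc (a := (0 : Fin (2 * k + 1) → ℝ)) (b := 1)).tendsto_subseq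
    (x := l) fun n => ⟨fun i => measureReal_nonneg, fun i => measureReal_le_one⟩
  have hcomb : ∀ c ∈ Icc (y - δ / 2) (y + δ / 2), ∑ i, L i * g i c = μ := by
    intro c hc
    refine tendsto_nhds_unique (tendsto_finsetSum _ fun i _ => ?_)
      ((key c hc).comp hφ.tendsto_atTop)
    exact ((tendsto_pi_nhds.1 hL) i).mul_const (g i c)
  -- All limit masses vanish, so the combination equal to `μ` is zero, contradicting `μ > 0`.
  have hzero := fun i => hN.coeff_eq_zero hdis hg (by linarith) (by linarith) (by linarith) hcomb i
  have := hcomb y ⟨by linarith, by linarith⟩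
  simp only [hzero, zero_mul, Finset.sum_const_zero] at this
  exact hμ.ne this

end IsRegularFlow

end QuasistaticVisco

theorem mainTheorem4 (σ : ℝ → ℝ) (μ : ℝ) (hμ : 0 < μ)
    (hσ : QuasistaticVisco.StressAssumptions σ)
    (hNC : QuasistaticVisco.Nondegenerate σ)
    (p₀ : ℝ → ℝ) (hp₀ : QuasistaticVisco.IsAdmissible μ p₀)
    (p : ℝ → ℝ → ℝ) (hp : QuasistaticVisco.IsSolution σ μ p₀ p) :
    ∃ pbar : ℝ → ℝ, QuasistaticVisco.IsEquilibrium σ μ pbar ∧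
      Tendsto (fun t => eLpNorm (fun x => p x t - pbar x) 2 QuasistaticVisco.unitMeasure)
        atTop (𝓝 0) := by
  obtain ⟨T, ε, K, Λ, hreg⟩ := hp.isFlow.exists_isRegularFlow hσ hNC.contDiff hμ
  obtain ⟨C, hC⟩ := hreg.exists_tendsto_meanStress hσ hNC hμ
  exact hreg.exists_equilibrium_of_tendsto hσ hNC hμ hC
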